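/- Let $m\in\mathbb N$, $x_\Sigma\in\mathbb{R}$, $\delta>0$, $P\subset\mathbb{R}^m$, and let $V_-\subset\{x_1<x_\Sigma+\delta\}$, $V_+\subset\{x_1>x_\Sigma-\delta\}$ be compact subsets of $\mathbb{R}^2$. Let $h_\pm(x,\mu)\in\mathbb{R}^2$ be vector fields that are smooth in $(x,\mu)$ on a neighbourhood of $V_\pm\times P$. Let $\Sigma=\{x_\Sigma\}\times[a,b]\subset V_-\cap V_+$ be a vertical section whose interior is crossed by both vector fields from left to right, i.e. the first components of $h_\pm(\cdot,\mu)$ are positive on $\{x_\Sigma\}\times(a,b)$ for all $\mu\in P$. Consider the piecewise-smooth planar system $$\dot x=h_-(x,\mu)\ \text{ on } U_-=V_-\cap\{x_1<x_\Sigma\},\qquad \dot x=h_+(x,\mu)\ \text{ on } U_+=V_+\cap\{x_1>x_\Sigma\}.$$ Suppose that for some $\mu_0$ in the interior of $P$ there is a piecewise-smooth heteroclinic orbit between (hyperbolic) saddles: $p_\pm\in U_\pm$ are saddle equilibria of $h_\pm(\cdot,\mu_0)$, $\gamma_-:(-\infty,0]\to U_-\cup\Sigma$ solves $\dot x=h_-(x,\mu_0)$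 with $\gamma_-(t)\in U_-$ for $t<0$ and $\gamma_-(t)\to p_-$ as $t\to-\infty$, $\gamma_+:[0,\infty)\to U_+\cup\Sigma$ solves $\dot x=h_+(x,\mu_0)$ with $\gamma_+(t)\in U_+$ for $t>0$ and $\gamma_+(t)\to p_+$ as $t\to\infty$, and $\gamma_-(0)=\gamma_+(0)=x_*\in\{x_\Sigma\}\times(a,b)$. Let $$(v_1^\pm,v_2^\pm)=\frac{h_\pm(x_*,\mu_0)}{\|h_\pm(x_*,\mu_0)\|},$$ and let $\psi_-$ on $(-\infty,0]$ and $\psi_+$ on $[0,\infty)$ be the solutions of the adjoint equations $\dot\psi_\pm=-D_xh_\pm(\gamma_\pm(t),\mu_0)^{\top}\psi_\pm$ with $\psi_\pm(0)=(-v_2^\pm,v_1^\pm)^{\top}$. Then the saddles $p_\pm$ continue to saddles $p_\pm(\mu)$ of $h_\pm(\cdot,\mu)$ for $\mu$ near $\mu_0$, continuously at $\mu_0$, with $p_\pm(\mu_0)=p_\pm$, and there are $\varepsilon_0>0$ and maps $z^u,z^s$ from $\mathbb{R}^m$ to $\mathbb{R}^2$ such that, for every $\varepsilon\in(0,\varepsilon_0]$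 and all $\mu$ sufficiently close to $\mu_0$ (depending on $\varepsilon$), $z^u(\mu)$ is the only point $x(0)$ in $\Sigma$ of trajectories $x:(-\infty,0]\to\mathbb{R}^2$ of $h_-(\cdot,\mu)$ in $W^u_\mu(p_-(\mu))$ (that is, $x(t)\to p_-(\mu)$ as $t\to-\infty$) with $x_1(t)<x_\Sigma$ for $t<0$ and $\|x(t)-\gamma_-(t)\|<\varepsilon$ for $t\le0$, and $z^s(\mu)$ is the only point $x(0)$ in $\Sigma$ of trajectories $x:[0,\infty)\to\mathbb{R}^2$ of $h_+(\cdot,\mu)$ in $W^s_\mu(p_+(\mu))$ with $x_1(t)>x_\Sigma$ for $t>0$ and $\|x(t)-\gamma_+(t)\|<\varepsilon$ for $t\ge0$. The signed vertical distance $G(\mu)=z^u_2(\mu)-z^s_2(\mu)$ between $W^u_\mu(p_-)$ and $W^s_\mu(p_+)$ on $\Sigma$ is differentiable at $\mu_0$, and for $i=1,\dots,m$ $$\frac{\partial G}{\partial\mu_i}(\mu_0)=\frac1{v_1^-}\int_{-\infty}^0\psi_-(s)^{\top}\frac{\partial h_-}{\partial\mu_i}(\gamma_-(s),\mu_0)\,ds+\frac1{v_1^+}\int_0^{\infty}\psi_+(s)^{\top}\frac{\partial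 h_+}{\partial\mu_i}(\gamma_+(s),\mu_0)\,ds,$$ where both integrals converge absolutely. -/

import Mathlib

open Set Filter Topology MeasureTheory
open scoped ContDiff

/-- The plane `ℝ²` with the Euclidean norm; `x 0` is the horizontal coordinate `x₁` and `x 1` is
the vertical coordinate `x₂`. -/
abbrev Plane : Type := EuclideanSpace ℝ (Fin 2)

/-- The parameter space `ℝᵐ`. -/
abbrev Param (m : ℕ) : Type := EuclideanSpace ℝ (Fin m)

/-- `p` is a (hyperbolic) saddle equilibrium of the planar vector field `f`: it is an equilibrium,
and the linearisation has a negative and a positive real eigenvalue. -/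
def IsSaddle (f : Plane → Plane) (p : Plane) : Prop :=
  f p = 0 ∧
    (∃ a : ℝ, a < 0 ∧ Module.End.HasEigenvalue (fderiv ℝ f p : Plane →ₗ[ℝ] Plane) a) ∧
    (∃ b : ℝ, 0 < b ∧ Module.End.HasEigenvalue (fderiv ℝ f p : Plane →ₗ[ℝ] Plane) b)

/-- `P` continues the saddle `p` of `h(·, μ₀)` to saddles `P μ` of `h(·, μ)` for `μ` near `μ₀`. -/
def IsSaddleContinuation {m : ℕ} (h : Plane → Param m → Plane) (μ₀ : Param m) (p : Plane)
    (P : Param m → Plane) : Prop :=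
  P μ₀ = p ∧ ContinuousAt P μ₀ ∧ ∀ᶠ μ in 𝓝 μ₀, IsSaddle (fun x => h x μ) (P μ)

/-- The vertical segment `{c} × [a, b]`. -/
def verticalSection (c a b : ℝ) : Set Plane := {z | z 0 = c ∧ z 1 ∈ Icc a b}

/-- The segment, near the reference trajectory `γ`, of the unstable manifold of the equilibrium `q`
of `f` in `{x₁ < c}`, extended up to the line `{x₁ = c}`: the set of endpoints `x(0)` of the
trajectories `x` of `f` on `(-∞, 0]` which tend to `q` as `t → -∞`, lie in `{x₁ < c}` for `t < 0`
and stay `ε`-close to `γ`. -/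
def unstableSegment (f : Plane → Plane) (q : Plane) (c : ℝ) (γ : ℝ → Plane) (ε : ℝ) : Set Plane :=
  {z | ∃ x : ℝ → Plane, IsIntegralCurveOn x (fun _ => f) (Iic 0) ∧ Tendsto x atBot (𝓝 q) ∧
    (∀ t < 0, x t 0 < c) ∧ (∀ t ≤ 0, dist (x t) (γ t) < ε) ∧ x 0 = z}

/-- The segment, near the reference trajectory `γ`, of the stable manifold of the equilibrium `q`
of `f` in `{x₁ > c}`, extended up to the line `{x₁ = c}`. -/
def stableSegment (f : Plane → Plane) (q : Plane) (c : ℝ) (γ : ℝ → Plane) (ε : ℝ) : Set Plane :=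
  {z | ∃ x : ℝ → Plane, IsIntegralCurveOn x (fun _ => f) (Ici 0) ∧ Tendsto x atTop (𝓝 q) ∧
    (∀ t > 0, c < x t 0) ∧ (∀ t ≥ 0, dist (x t) (γ t) < ε) ∧ x 0 = z}

/-- `ψ` solves on `J` the adjoint equation `ψ' + A(t)ᵀ ψ = 0`, where `A(t) = Df(γ(t))`. -/
def IsAdjointSolutionOn (f : Plane → Plane) (γ : ℝ → Plane) (ψ : ℝ → Plane) (J : Set ℝ) : Prop :=
  IsIntegralCurveOn ψ
    (fun t y => -(ContinuousLinearMap.adjoint (fderiv ℝ f (γ t)) y)) J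

/-- The normalised vector `w / ‖w‖`. -/
noncomputable def normalised (w : Plane) : Plane := ‖w‖⁻¹ • w

/-- The Melnikov integrand `ψ(s)ᵀ ∂h/∂μᵢ(γ(s), μ₀)`. -/
noncomputable def melnikovIntegrand {m : ℕ} (h : Plane → Param m → Plane) (μ₀ : Param m)
    (γ ψ : ℝ → Plane) (i : Fin m) (s : ℝ) : ℝ :=
  inner ℝ (ψ s) (fderiv ℝ (fun μ => h (γ s) μ) μ₀ (EuclideanSpace.single i 1))

/-! Each half of the orbit is treated separately, and time reversal turns the stable half into an
unstable one: `t ↦ γ₊(-t)` is an orbit of `-h₊` that emanates from a saddle and reaches the section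
from the other side. A sign `σ = ±1` lets `IsTransversalOrbit` cover both cases, so only orbits on
`(-∞, 0]` need study.

For such an orbit `γ`, a trajectory `γ + y` of `h(·, μ)` satisfies `y' = A(t) y + N(y, μ)` with `A =
D_x h(γ, μ₀)`. The velocity `φ = γ'` is a bounded solution of the linear part. In the orthonormal
frame made of the direction of `φ` and its normal, the linear system is triangular. Near the saddle
`φ` lies in a narrow cone about the unstable direction (`exists_cone`), so the tangential component
is expanded. By the trace identity the normal component is contracted (`exists_rates`). Hence
boundedness at `-∞` determines the normal component, and the condition that the endpoint lie on the
vertical line determines the tangential one by transversality (`exists_estimate_linear`). A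
contraction argument then gives a unique nearby trajectory for each `μ`, at distance `O(‖μ - μ₀‖)`
(`exists_unique_nearby`). It tends to the continued saddle and first meets the section at time `0`
(`exists_tendsto`, `exists_side`).

The adjoint solution starts orthogonal to `φ`, stays so, and decays exponentially backwards
(`exists_adjoint_decay`). In the derivative of `⟨ψ, y⟩` the linear terms cancel. Integrating over
`(-∞, 0]` therefore expresses `ψ₂(0) y₂(0)` as the Melnikov integral applied to `μ - μ₀` plus `o(‖μ
- μ₀‖)` (`hasFDerivAt_endpoint`). Since `ψ₂(0)` is the first component of the normalised field, the
weight `1/v₁` appears. -/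

/-! ### Scalar linear equations on the half-line with rates of one sign. -/

section ScalarEquations

/-- Continuous functions on `(-∞, 0]` have primitives there that vanish at `0`. -/
theorem exists_primitive_Iic {l : ℝ → ℝ} (hl : ContinuousOn l (Iic 0)) :
    ∃ Λ : ℝ → ℝ, Λ 0 = 0 ∧ ∀ t ∈ Iic (0 : ℝ), HasDerivWithinAt Λ (l t) (Iic 0) t := by
  have hc : Continuous fun t : ℝ => l (min t 0) :=
    hl.comp_continuous (by fun_prop) (fun t => min_le_right t 0)
  refine ⟨fun t => ∫ s in (0 : ℝ)..t, l (min s 0), by simp, fun t ht => ?_⟩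
  have h := (hc.integral_hasStrictDerivAt 0 t).hasDerivAt.hasDerivWithinAt (s := Iic 0)
  rwa [min_eq_left ht] at h

theorem HasDerivWithinAt.Iic_hasDerivAt {E : Type*} [NormedAddCommGroup E] [NormedSpace ℝ E]
    {f : ℝ → E} {f' : E} {T t : ℝ} (h : HasDerivWithinAt f f' (Iic T) t) (ht : t < T) :
    HasDerivAt f f' t :=
  h.hasDerivAt (Iic_mem_nhds ht)

theorem monotoneOn_Iic_of_hasDerivWithinAt {f f' : ℝ → ℝ} {T : ℝ}
    (h : ∀ t ∈ Iic T, HasDerivWithinAt f (f' t) (Iic T) t) (h0 : ∀ t ∈ Iic T, 0 ≤ f' t) :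
    MonotoneOn f (Iic T) := by
  refine monotoneOn_of_deriv_nonneg (convex_Iic T) (fun t ht => (h t ht).continuousWithinAt)
    ?_ ?_
  · intro t ht
    rw [interior_Iic] at ht
    exact ((h t (mem_Iic.2 (le_of_lt ht))).Iic_hasDerivAt ht).differentiableAt.differentiableWithinAt
  · intro t ht
    rw [interior_Iic] at ht
    rw [((h t (mem_Iic.2 (le_of_lt ht))).Iic_hasDerivAt ht).deriv]
    exact h0 t (mem_Iic.2 (le_of_lt ht))

theorem antitoneOn_Iic_of_hasDerivWithinAt {f f' : ℝ → ℝ} {T : ℝ}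
    (h : ∀ t ∈ Iic T, HasDerivWithinAt f (f' t) (Iic T) t) (h0 : ∀ t ∈ Iic T, f' t ≤ 0) :
    AntitoneOn f (Iic T) := by
  have := monotoneOn_Iic_of_hasDerivWithinAt (f := fun t => -f t) (f' := fun t => -f' t)
    (fun t ht => (h t ht).neg) (fun t ht => by simpa using h0 t ht)
  intro x hx y hy hxy
  simpa using this hx hy hxy

/-- A primitive of a function bounded above by `-α` decays at least linearly. -/
theorem le_mul_of_deriv_le {l Λ : ℝ → ℝ} {α : ℝ} (hl : ∀ t ∈ Iic (0 : ℝ), l t ≤ -α)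
    (hΛ : ∀ t ∈ Iic (0 : ℝ), HasDerivWithinAt Λ (l t) (Iic 0) t) {s t : ℝ} (hst : s ≤ t)
    (ht : t ≤ 0) : Λ t - Λ s ≤ -α * (t - s) := by
  have := antitoneOn_Iic_of_hasDerivWithinAt (f := fun t => Λ t + α * t)
    (f' := fun t => l t + α * 1) (T := 0)
    (fun t ht => (hΛ t ht).add (((hasDerivAt_id t).const_mul α).hasDerivWithinAt))
    (fun t ht => by have := hl t ht; linarith)
  have := this (hst.trans ht) ht hst
  simp only at this
  linarith

/-- With `Λ' = l`, the quantity `(q - G/α) e^{-Λ}` is nonincreasing. Because `e^{-Λ}` decays at `-∞`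
and `q` is bounded, its limit there is `0`, so it is nonpositive throughout. The lower bound follows
later by passing to `-q`. -/
theorem bounded_of_contracting_le {l g q : ℝ → ℝ} {α G C : ℝ} (hα : 0 < α)
    (hlc : ContinuousOn l (Iic 0)) (hl : ∀ t ∈ Iic (0 : ℝ), l t ≤ -α)
    (hg : ∀ t ∈ Iic (0 : ℝ), |g t| ≤ G)
    (hq : ∀ t ∈ Iic (0 : ℝ), HasDerivWithinAt q (l t * q t + g t) (Iic 0) t)
    (hqC : ∀ t ∈ Iic (0 : ℝ), |q t| ≤ C) {t : ℝ} (ht : t ≤ 0) : q t ≤ G / α := by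
  obtain ⟨Λ, hΛ0, hΛ⟩ := exists_primitive_Iic hlc
  have hG : 0 ≤ G := (abs_nonneg _).trans (hg 0 self_mem_Iic)
  have hexp : ∀ t ∈ Iic (0 : ℝ), HasDerivWithinAt (fun t => Real.exp (-Λ t))
      (Real.exp (-Λ t) * -(l t)) (Iic 0) t := fun t ht => (hΛ t ht).neg.exp
  have hanti := antitoneOn_Iic_of_hasDerivWithinAt (T := 0)
    (fun t ht => ((hq t ht).sub_const (G / α)).mul (hexp t ht)) (fun t ht => by
      have h1 := (abs_le.1 (hg t ht)).2
      have h2 := hl t ht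
      have h3 : G ≤ G / α * -l t := by
        rw [div_mul_eq_mul_div, le_div_iff₀ hα]; nlinarith
      have : (l t * q t + g t) * Real.exp (-Λ t) + (q t - G / α) * (Real.exp (-Λ t) * -l t)
        = Real.exp (-Λ t) * (g t - G / α * -l t) := by ring
      rw [this]
      exact mul_nonpos_of_nonneg_of_nonpos (Real.exp_pos _).le (by linarith))
  have hdec : Tendsto (fun s => Real.exp (-Λ s)) atBot (𝓝 0) := by
    have h1 : Tendsto (fun s : ℝ => Real.exp (α * s)) atBot (𝓝 0) :=
      Real.tendsto_exp_atBot.comp (tendsto_id.const_mul_atBot hα)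
    refine tendsto_of_tendsto_of_tendsto_of_le_of_le' tendsto_const_nhds h1
      (Eventually.of_forall fun _ => (Real.exp_pos _).le) ?_
    filter_upwards [eventually_le_atBot (0 : ℝ)] with s hs
    have := le_mul_of_deriv_le hl hΛ hs le_rfl
    rw [hΛ0] at this
    exact Real.exp_le_exp.2 (by linarith)
  have hlim : Tendsto (fun s => (q s - G / α) * Real.exp (-Λ s)) atBot (𝓝 0) := by
    have h2 : Tendsto (fun s => (C + G / α) * Real.exp (-Λ s)) atBot (𝓝 0) := by
      simpa using hdec.const_mul (C + G / α)
    refine squeeze_zero_norm' ?_ h2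
    filter_upwards [eventually_le_atBot (0 : ℝ)] with s hs
    rw [norm_mul, Real.norm_eq_abs, Real.norm_eq_abs, abs_of_pos (Real.exp_pos _)]
    gcongr
    have : |G / α| = G / α := abs_of_nonneg (by positivity)
    calc |q s - G / α| ≤ |q s| + |G / α| := abs_sub _ _
      _ ≤ _ := by rw [this]; have := hqC s hs; linarith
  have hle : (q t - G / α) * Real.exp (-Λ t) ≤ 0 := by
    refine ge_of_tendsto hlim ?_
    filter_upwards [eventually_le_atBot t] with s hs
    exact hanti (hs.trans ht) ht hs
  have := nonpos_of_mul_nonpos_left hle (Real.exp_pos _)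
  linarith

/-- Bounded solutions of a uniformly contracting scalar equation on `(-∞, 0]` are controlled by the
forcing term. -/
theorem abs_le_of_contracting {l g q : ℝ → ℝ} {α G C : ℝ} (hα : 0 < α)
    (hlc : ContinuousOn l (Iic 0)) (hl : ∀ t ∈ Iic (0 : ℝ), l t ≤ -α)
    (hg : ∀ t ∈ Iic (0 : ℝ), |g t| ≤ G)
    (hq : ∀ t ∈ Iic (0 : ℝ), HasDerivWithinAt q (l t * q t + g t) (Iic 0) t)
    (hqC : ∀ t ∈ Iic (0 : ℝ), |q t| ≤ C) {t : ℝ} (ht : t ≤ 0) : |q t| ≤ G / α := by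
  refine abs_le'.2 ⟨bounded_of_contracting_le hα hlc hl hg hq hqC ht,
    bounded_of_contracting_le (q := fun t => -q t) (g := fun t => -g t) hα hlc hl
      (by simpa using hg) (fun t ht => ?_) (by simpa using hqC) ht⟩
  exact (hq t ht).neg.congr_deriv (by ring)

/-- A uniformly contracting scalar equation on `(-∞, 0]` with bounded forcing has a bounded
solution. -/
theorem exists_bounded_of_contracting {l g : ℝ → ℝ} {α G : ℝ} (hα : 0 < α)
    (hlc : ContinuousOn l (Iic 0)) (hl : ∀ t ∈ Iic (0 : ℝ), l t ≤ -α)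
    (hgc : ContinuousOn g (Iic 0)) (hg : ∀ t ∈ Iic (0 : ℝ), |g t| ≤ G) :
    ∃ (q : ℝ → ℝ) (C : ℝ), (∀ t ∈ Iic (0 : ℝ), |q t| ≤ C) ∧
      ∀ t ∈ Iic (0 : ℝ), HasDerivWithinAt q (l t * q t + g t) (Iic 0) t := by
  obtain ⟨Λ, hΛ0, hΛ⟩ := exists_primitive_Iic hlc
  have hG : 0 ≤ G := (abs_nonneg _).trans (hg 0 self_mem_Iic)
  have hΛc : ContinuousOn Λ (Iic 0) := fun t ht => (hΛ t ht).continuousWithinAt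
  set F : ℝ → ℝ := fun s => Real.exp (-Λ s) * g s with hF
  have hFc : ContinuousOn F (Iic 0) := (Real.continuous_exp.comp_continuousOn hΛc.neg).mul hgc
  obtain ⟨Φ, hΦ0, hΦ⟩ := exists_primitive_Iic hFc
  have hFbd : ∀ {s t : ℝ}, s ≤ t → t ≤ 0 → |F s| ≤ G * Real.exp (-Λ t - α * t) * Real.exp (α * s) := by
    intro s t hst ht
    have h1 := le_mul_of_deriv_le hl hΛ hst ht
    rw [hF, abs_mul, abs_of_pos (Real.exp_pos _), mul_assoc, ← Real.exp_add, mul_comm G]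
    gcongr
    · linarith
    · exact hg s (hst.trans ht)
  have hint : ∀ t : ℝ, t ≤ 0 → IntegrableOn F (Iic t) := by
    intro t ht
    have h1 : IntegrableOn (fun s => G * Real.exp (-Λ t - α * t) * Real.exp (α * s)) (Iic t) :=
      (integrableOn_exp_mul_Iic hα t).const_mul _
    refine h1.mono' ((hFc.mono (Iic_subset_Iic.2 ht)).aestronglyMeasurable measurableSet_Iic) ?_
    exact (ae_restrict_mem measurableSet_Iic).mono fun s hs => hFbd hs ht
  -- The bounded solution is variation of constants started at `-∞`, namely `e^{Λ t} ∫_{-∞}^t e^{-Λ}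
  -- g`. Splitting off the constant `I` lets it be differentiated through the primitive `Φ` based at
  -- `0`.
  set I := ∫ s in Iic (0 : ℝ), F s
  have hΦI : ∀ t ∈ Iic (0 : ℝ), I + Φ t = ∫ s in Iic t, F s := by
    intro t ht
    have h1 := intervalIntegral.integral_Iic_sub_Iic (hint t ht) (hint 0 le_rfl)
    have h2 : ∫ s in t..0, F s = Φ 0 - Φ t := by
      refine intervalIntegral.integral_eq_sub_of_hasDerivAt_of_le ht
        (fun s hs => (hΦ s hs.2).continuousWithinAt.mono Icc_subset_Iic_self)
        (fun s hs => (hΦ s hs.2.le).Iic_hasDerivAt hs.2) ?_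
      exact (hFc.mono (by rw [uIcc_of_le ht]; exact Icc_subset_Iic_self)).intervalIntegrable
    rw [h2, hΦ0] at h1
    linarith
  refine ⟨fun t => Real.exp (Λ t) * (I + Φ t), G / α, fun t ht => ?_, fun t ht => ?_⟩
  · have h1 : |I + Φ t| ≤ ∫ s in Iic t, G * Real.exp (-Λ t - α * t) * Real.exp (α * s) := by
      rw [hΦI t ht, ← Real.norm_eq_abs]
      refine norm_integral_le_of_norm_le ((integrableOn_exp_mul_Iic hα t).const_mul _) ?_
      exact (ae_restrict_mem measurableSet_Iic).mono fun s hs => hFbd hs ht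
    rw [integral_const_mul, integral_exp_mul_Iic hα] at h1
    rw [abs_mul, abs_of_pos (Real.exp_pos _)]
    calc Real.exp (Λ t) * |I + Φ t|
        ≤ Real.exp (Λ t) * (G * Real.exp (-Λ t - α * t) * (Real.exp (α * t) / α)) := by gcongr
      _ = G / α * (Real.exp (Λ t) * Real.exp (-Λ t - α * t) * Real.exp (α * t)) := by ring
      _ = G / α := by 
        rw [← Real.exp_add, ← Real.exp_add,
          show Λ t + (-Λ t - α * t) + α * t = 0 by ring, Real.exp_zero, mul_one]
  · refine ((hΛ t ht).exp.mul ((hΦ t ht).const_add I)).congr_deriv ?_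
    have : Real.exp (Λ t) * F t = g t := by
      rw [hF, ← mul_assoc, ← Real.exp_add]; simp
    rw [this]; ring

/-- Here `(p - G/α) e^{-Λ}` is nondecreasing and `e^{-Λ} ≥ 1` on `(-∞, 0]`, so the value at `0`
controls the past. Boundedness of `p` is a consequence rather than an assumption, in contrast to the
contracting case. -/
theorem bounded_of_expanding_le {l g p : ℝ → ℝ} {α G : ℝ} (hα : 0 < α)
    (hlc : ContinuousOn l (Iic 0)) (hl : ∀ t ∈ Iic (0 : ℝ), α ≤ l t)
    (hg : ∀ t ∈ Iic (0 : ℝ), |g t| ≤ G)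
    (hp : ∀ t ∈ Iic (0 : ℝ), HasDerivWithinAt p (l t * p t + g t) (Iic 0) t)
    {t : ℝ} (ht : t ≤ 0) : p t ≤ |p 0| + G / α := by
  obtain ⟨Λ, hΛ0, hΛ⟩ := exists_primitive_Iic hlc
  have hG : 0 ≤ G := (abs_nonneg _).trans (hg 0 self_mem_Iic)
  have hexp : ∀ t ∈ Iic (0 : ℝ), HasDerivWithinAt (fun t => Real.exp (-Λ t))
      (Real.exp (-Λ t) * -(l t)) (Iic 0) t := fun t ht => (hΛ t ht).neg.exp
  have hmono := monotoneOn_Iic_of_hasDerivWithinAt (T := 0)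
    (fun t ht => ((hp t ht).sub_const (G / α)).mul (hexp t ht)) (fun t ht => by
      have h1 := (abs_le.1 (hg t ht)).1
      have h2 := hl t ht
      have h3 : G ≤ G / α * l t := by
        rw [div_mul_eq_mul_div, le_div_iff₀ hα]; nlinarith
      have : (l t * p t + g t) * Real.exp (-Λ t) + (p t - G / α) * (Real.exp (-Λ t) * -l t)
        = Real.exp (-Λ t) * (g t + G / α * l t) := by ring
      rw [this]
      exact mul_nonneg (Real.exp_pos _).le (by linarith))
  have h1 := hmono ht (le_refl (0 : ℝ)) ht
  simp only [hΛ0, neg_zero, Real.exp_zero, mul_one, Pi.mul_apply] at h1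
  have h2 : 1 ≤ Real.exp (-Λ t) := by
    have := le_mul_of_deriv_le (l := fun t => -l t) (Λ := fun t => -Λ t) (α := α)
      (fun t ht => by have := hl t ht; linarith) (fun t ht => (hΛ t ht).neg) ht le_rfl
    rw [hΛ0] at this
    refine Real.one_le_exp ?_
    nlinarith
  have h3 := le_abs_self (p 0)
  have h4 : 0 ≤ G / α := by positivity
  by_contra! hlt
  nlinarith [abs_nonneg (p 0)]

/-- Solutions of a uniformly expanding scalar equation on `(-∞, 0]` are controlled by their final
value and the forcing term. -/
theorem abs_le_of_expanding {l g p : ℝ → ℝ} {α G : ℝ} (hα : 0 < α)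
    (hlc : ContinuousOn l (Iic 0)) (hl : ∀ t ∈ Iic (0 : ℝ), α ≤ l t)
    (hg : ∀ t ∈ Iic (0 : ℝ), |g t| ≤ G)
    (hp : ∀ t ∈ Iic (0 : ℝ), HasDerivWithinAt p (l t * p t + g t) (Iic 0) t)
    {t : ℝ} (ht : t ≤ 0) : |p t| ≤ |p 0| + G / α := by
  refine abs_le'.2 ⟨bounded_of_expanding_le hα hlc hl hg hp ht, ?_⟩
  have := bounded_of_expanding_le (p := fun t => -p t) (g := fun t => -g t) hα hlc hl
      (by simpa using hg) (fun t ht => ?_) ht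
  · simpa using this
  exact (hp t ht).neg.congr_deriv (by ring)

theorem exists_solution_linear {l g : ℝ → ℝ} (hlc : ContinuousOn l (Iic 0))
    (hgc : ContinuousOn g (Iic 0)) (p₀ : ℝ) :
    ∃ p : ℝ → ℝ, p 0 = p₀ ∧
      ∀ t ∈ Iic (0 : ℝ), HasDerivWithinAt p (l t * p t + g t) (Iic 0) t := by
  obtain ⟨Λ, hΛ0, hΛ⟩ := exists_primitive_Iic hlc
  have hΛc : ContinuousOn Λ (Iic 0) := fun t ht => (hΛ t ht).continuousWithinAt
  obtain ⟨Φ, hΦ0, hΦ⟩ := exists_primitive_Iic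
    ((Real.continuous_exp.comp_continuousOn hΛc.neg).mul hgc)
  refine ⟨fun t => Real.exp (Λ t) * (p₀ + Φ t), by simp [hΛ0, hΦ0], fun t ht => ?_⟩
  refine ((hΛ t ht).exp.mul ((hΦ t ht).const_add p₀)).congr_deriv ?_
  have : Real.exp (Λ t) * (Real.exp (-Λ t) * g t) = g t := by
    rw [← mul_assoc, ← Real.exp_add]; simp
  change _ + Real.exp (Λ t) * (Real.exp (-Λ t) * g t) = _
  rw [this]; ring

end ScalarEquations

/-! ### Planar linear maps: saddles, spectral splitting, rotated frames. -/

section PlanarLinearAlgebra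

/-- The matrix entries of a linear map of the plane. -/
noncomputable def Plane.entry (A : Plane →L[ℝ] Plane) (i j : Fin 2) : ℝ :=
  A (EuclideanSpace.single j 1) i

noncomputable def Plane.tr (A : Plane →L[ℝ] Plane) : ℝ := Plane.entry A 0 0 + Plane.entry A 1 1

noncomputable def Plane.determinant (A : Plane →L[ℝ] Plane) : ℝ :=
  Plane.entry A 0 0 * Plane.entry A 1 1 - Plane.entry A 0 1 * Plane.entry A 1 0

theorem Plane.inner_eq (v w : Plane) : inner ℝ v w = v 0 * w 0 + v 1 * w 1 := by
  simp [PiLp.inner_apply, Fin.sum_univ_two, mul_comm]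

theorem Plane.apply_eq (A : Plane →L[ℝ] Plane) (w : Plane) (i : Fin 2) :
    A w i = Plane.entry A i 0 * w 0 + Plane.entry A i 1 * w 1 := by
  have hw : w = w 0 • EuclideanSpace.single 0 1 + w 1 • EuclideanSpace.single 1 1 := by
    ext j; fin_cases j <;> simp
  conv_lhs => rw [hw]
  simp only [map_add, map_smul, PiLp.add_apply, PiLp.smul_apply, smul_eq_mul, Plane.entry]
  ring

theorem Plane.ext_coord {v w : Plane} (h0 : v 0 = w 0) (h1 : v 1 = w 1) : v = w := by
  ext j; fin_cases j <;> assumption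

theorem Plane.hasEigenvalue_iff (A : Plane →L[ℝ] Plane) (c : ℝ) :
    Module.End.HasEigenvalue (A : Plane →ₗ[ℝ] Plane) c ↔
      c ^ 2 - Plane.tr A * c + Plane.determinant A = 0 := by
  unfold Plane.tr Plane.determinant
  constructor
  · intro h
    obtain ⟨v, hv⟩ := h.exists_hasEigenvector
    have hAv : A v = c • v := hv.apply_eq_smul
    have h0 : A v 0 = c * v 0 := by rw [hAv]; simp
    have h1 : A v 1 = c * v 1 := by rw [hAv]; simp
    rw [Plane.apply_eq] at h0 h1
    have hne : v 0 ≠ 0 ∨ v 1 ≠ 0 := by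
      by_contra! hz
      exact hv.2 (Plane.ext_coord (by simpa using hz.1) (by simpa using hz.2))
    rcases hne with hne | hne
    · apply mul_left_cancel₀ hne
      linear_combination (Plane.entry A 1 1 - c) * h0 - Plane.entry A 0 1 * h1
    · apply mul_left_cancel₀ hne
      linear_combination (Plane.entry A 0 0 - c) * h1 - Plane.entry A 1 0 * h0
  · intro h
    have key : ∀ v : Plane, v ≠ 0 →
        (Plane.entry A 0 0 - c) * v 0 + Plane.entry A 0 1 * v 1 = 0 →
        Plane.entry A 1 0 * v 0 + (Plane.entry A 1 1 - c) * v 1 = 0 →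
        Module.End.HasEigenvalue (A : Plane →ₗ[ℝ] Plane) c := by
      intro v hv h0 h1
      refine Module.End.hasEigenvalue_of_hasEigenvector (x := v)
        (Module.End.hasEigenvector_iff.2 ⟨Module.End.mem_eigenspace_iff.2 ?_, hv⟩)
      refine Plane.ext_coord ?_ ?_
      · change A v 0 = c * v 0
        rw [Plane.apply_eq]; linarith
      · change A v 1 = c * v 1
        rw [Plane.apply_eq]; linarith
    have hne : ∀ x y : ℝ, x ≠ 0 ∨ y ≠ 0 → (!₂[x, y] : Plane) ≠ 0 := by
      intro x y hxy h
      have h0 := congrArg (fun w : Plane => w 0) h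
      have h1 := congrArg (fun w : Plane => w 1) h
      simp at h0 h1
      tauto
    -- A kernel vector of `A - c` is obtained by rotating a nonzero row. If both rows vanish, `A` is
    -- scalar and any nonzero vector serves.
    by_cases h1 : Plane.entry A 0 0 - c ≠ 0 ∨ Plane.entry A 0 1 ≠ 0
    · refine key !₂[-Plane.entry A 0 1, Plane.entry A 0 0 - c]
        (hne _ _ (by rw [neg_ne_zero]; tauto)) ?_ ?_ <;> simp <;> linarith
    push Not at h1
    by_cases h2 : Plane.entry A 1 0 ≠ 0 ∨ Plane.entry A 1 1 - c ≠ 0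
    · refine key !₂[Plane.entry A 1 1 - c, -Plane.entry A 1 0]
        (hne _ _ (by rw [neg_ne_zero]; tauto)) ?_ ?_
      · simp [h1.1, h1.2]
      · simp; ring
    push Not at h2
    exact key !₂[1, 0] (hne _ _ (by simp)) (by simp [h1.1]) (by simp [h2.1])

theorem Plane.exists_roots {A : Plane →L[ℝ] Plane} (h : Plane.determinant A < 0) :
    ∃ a b : ℝ, a < 0 ∧ 0 < b ∧ a + b = Plane.tr A ∧ a * b = Plane.determinant A := by
  set T := Plane.tr A
  set d := Plane.determinant A
  have hd : 0 ≤ T ^ 2 - 4 * d := by nlinarith [sq_nonneg T]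
  have hs := Real.sq_sqrt hd
  have h1 : |T| < √(T ^ 2 - 4 * d) := Real.lt_sqrt_of_sq_lt (by rw [sq_abs]; linarith)
  obtain ⟨h2, h3⟩ := abs_lt.1 h1
  exact ⟨(T - √(T ^ 2 - 4 * d)) / 2, (T + √(T ^ 2 - 4 * d)) / 2, by linarith, by linarith,
    by ring, by linear_combination -hs / 4⟩

/-- The two eigenvalues have product equal to the determinant. The sign condition on the determinant
is open, which makes it the convenient form for perturbation. -/
theorem isSaddle_iff {f : Plane → Plane} {p : Plane} :
    IsSaddle f p ↔ f p = 0 ∧ Plane.determinant (fderiv ℝ f p) < 0 := by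
  unfold IsSaddle
  simp only [Plane.hasEigenvalue_iff]
  refine and_congr_right fun _ => ⟨?_, fun h => ?_⟩
  · rintro ⟨⟨a, ha, h1⟩, b, hb, h2⟩
    have h3 : (b - a) * (a + b - Plane.tr (fderiv ℝ f p)) = 0 := by linear_combination h2 - h1
    rcases mul_eq_zero.1 h3 with h4 | h4
    · linarith
    · nlinarith
  · obtain ⟨a, b, ha, hb, h1, h2⟩ := Plane.exists_roots h
    exact ⟨⟨a, ha, by rw [← h1, ← h2]; ring⟩, b, hb, by rw [← h1, ← h2]; ring⟩

/-- The spectral splitting of a planar linear map of saddle type. -/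
theorem Plane.exists_splitting {A : Plane →L[ℝ] Plane} (h : Plane.determinant A < 0) :
    ∃ (a b : ℝ) (πs πu : Plane →L[ℝ] Plane), a < 0 ∧ 0 < b ∧ a + b = Plane.tr A ∧
      (∀ w, πs w + πu w = w) ∧ (∀ w, πs (A w) = a • πs w) ∧ (∀ w, πu (A w) = b • πu w) ∧
      ∀ w, A w = a • πs w + b • πu w := by
  obtain ⟨a, b, ha, hb, h1, h2⟩ := Plane.exists_roots h
  have hab : b - a ≠ 0 := by linarith
  -- By Cayley–Hamilton, `(b - A)/(b - a)` and `(A - a)/(b - a)` are the spectral projections.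
  have hCH : ∀ w, A (A w) = (a + b) • A w - (a * b) • w := by
    intro w
    rw [h1, h2]
    refine Plane.ext_coord ?_ ?_ <;>
    · simp only [PiLp.sub_apply, PiLp.smul_apply, smul_eq_mul, Plane.apply_eq A,
        Plane.tr, Plane.determinant]
      ring
  refine ⟨a, b, (b - a)⁻¹ • (b • ContinuousLinearMap.id ℝ Plane - A),
    (b - a)⁻¹ • (A - a • ContinuousLinearMap.id ℝ Plane), ha, hb, h1, fun w => ?_, fun w => ?_,
    fun w => ?_, fun w => ?_⟩
  · refine Plane.ext_coord ?_ ?_ <;>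
    · simp; field_simp; ring
  · simp only [smul_apply, sub_apply, hCH,
      ContinuousLinearMap.id_apply]
    module
  · simp only [smul_apply, sub_apply, hCH,
      ContinuousLinearMap.id_apply]
    module
  · refine Plane.ext_coord ?_ ?_ <;>
    · simp; field_simp; ring

/-- Rotation of the plane by a right angle. -/
noncomputable def Plane.rot : Plane →L[ℝ] Plane :=
  LinearMap.toContinuousLinearMap
    { toFun := fun w => !₂[-(w 1), w 0]
      map_add' := fun v w => Plane.ext_coord (by simp; ring) (by simp)
      map_smul' := fun c w => Plane.ext_coord (by simp) (by simp) }

@[simp] theorem Plane.rot_zero (w : Plane) : Plane.rot w 0 = -(w 1) := rfl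

@[simp] theorem Plane.rot_one (w : Plane) : Plane.rot w 1 = w 0 := rfl

theorem Plane.sq_add_sq {e : Plane} (he : ‖e‖ = 1) : e 0 ^ 2 + e 1 ^ 2 = 1 := by
  have := EuclideanSpace.norm_sq_eq e
  rw [he] at this
  simpa [Fin.sum_univ_two] using this.symm

theorem Plane.norm_rot (e : Plane) : ‖Plane.rot e‖ = ‖e‖ := by
  simp [EuclideanSpace.norm_eq, Fin.sum_univ_two, add_comm]

/-- The trace can be computed in any orthonormal basis. This converts a lower bound on the rate
along `e` into an upper bound on the normal rate, when combined with the sum of the eigenvalues. -/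
theorem Plane.inner_add_inner_rot (A : Plane →L[ℝ] Plane) {e : Plane} (he : ‖e‖ = 1) :
    inner ℝ e (A e) + inner ℝ (Plane.rot e) (A (Plane.rot e)) = Plane.tr A := by
  have := Plane.sq_add_sq he
  simp only [Plane.inner_eq, Plane.apply_eq A, Plane.rot_zero, Plane.rot_one, Plane.tr]
  linear_combination (Plane.entry A 0 0 + Plane.entry A 1 1) * this

theorem Plane.eq_frame {e : Plane} (he : ‖e‖ = 1) (w : Plane) :
    w = inner ℝ e w • e + inner ℝ (Plane.rot e) w • Plane.rot e := by
  have := Plane.sq_add_sq he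
  refine Plane.ext_coord ?_ ?_ <;>
    simp only [PiLp.add_apply, PiLp.smul_apply, smul_eq_mul, Plane.inner_eq, Plane.rot_zero,
      Plane.rot_one]
  · linear_combination -w 0 * this
  · linear_combination -w 1 * this

end PlanarLinearAlgebra

/-! ### Cones and decay for perturbed saddle-type linear equations. -/

section Dichotomy

variable {E : Type*} [NormedAddCommGroup E] [InnerProductSpace ℝ E]

theorem hasDerivWithinAt_norm_sq_clm {w : ℝ → E} {w' : E} {s : Set ℝ} {t : ℝ} (π : E →L[ℝ] E)
    (h : HasDerivWithinAt w w' s t) :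
    HasDerivWithinAt (fun t => ‖π (w t)‖ ^ 2) (2 * inner ℝ (π (w t)) (π w')) s t :=
  (π.hasFDerivAt.comp_hasDerivWithinAt t h).norm_sq

/-- Half the derivative of `‖π w‖²` is `c ‖π w‖²` up to the contribution of `w' - A w`, since `π`
diagonalises `A`. -/
theorem abs_inner_perturbation_le {A π : E →L[ℝ] E} {c k κ : ℝ} {w w' : E}
    (hπ : π (A w) = c • π w) (hk : ‖π‖ * κ ≤ k) (hw : ‖w' - A w‖ ≤ κ * ‖w‖) :
    |inner ℝ (π w) (π w') - c * ‖π w‖ ^ 2| ≤ k * ‖π w‖ * ‖w‖ := by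
  have h1 : π w' = c • π w + π (w' - A w) := by rw [map_sub, hπ]; abel
  have h2 : inner ℝ (π w) (π w') - c * ‖π w‖ ^ 2 = inner ℝ (π w) (π (w' - A w)) := by
    rw [h1, inner_add_right, real_inner_smul_right, real_inner_self_eq_norm_sq]; ring
  rw [h2]
  calc |inner ℝ (π w) (π (w' - A w))| ≤ ‖π w‖ * ‖π (w' - A w)‖ := abs_real_inner_le_norm _ _
    _ ≤ ‖π w‖ * (‖π‖ * (κ * ‖w‖)) := by
        gcongr; exact (π.le_opNorm _).trans (by gcongr)
    _ = (‖π‖ * κ) * (‖π w‖ * ‖w‖) := by ring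
    _ ≤ k * (‖π w‖ * ‖w‖) := by gcongr
    _ = _ := by ring

/-- Bounded backward solutions of a small perturbation of a linear equation of saddle type lie in a
narrow cone about the unstable direction. -/
theorem exists_cone {A πs πu : E →L[ℝ] E} {a b : ℝ} (ha : a < 0) (hb : 0 < b)
    (hsum : ∀ w, πs w + πu w = w) (hs : ∀ w, πs (A w) = a • πs w)
    (hu : ∀ w, πu (A w) = b • πu w) {η : ℝ} (hη : 0 < η) (hη1 : η ≤ 1) :
    ∃ κ > 0, ∀ (T : ℝ) (w w' : ℝ → E),
      (∀ t ∈ Iic T, HasDerivWithinAt w (w' t) (Iic T) t) →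
      (∀ t ∈ Iic T, ‖w' t - A (w t)‖ ≤ κ * ‖w t‖) → (∃ C, ∀ t ∈ Iic T, ‖w t‖ ≤ C) →
      ∀ t ∈ Iic T, ‖πs (w t)‖ ≤ η * ‖πu (w t)‖ := by
  set c := ‖πs‖ + ‖πu‖ + 1 with hc
  have hc0 : 0 < c := by positivity
  set k := min (-a) (η ^ 2 * b) / 4 with hk
  have hk0 : 0 < k := by
    have : 0 < min (-a) (η ^ 2 * b) := lt_min (by linarith) (by positivity)
    positivity
  have hk1 : 4 * k ≤ -a := by have := min_le_left (-a) (η ^ 2 * b); linarith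
  have hk2 : 4 * k ≤ η ^ 2 * b := by have := min_le_right (-a) (η ^ 2 * b); linarith
  have hks : ‖πs‖ * (k / c) ≤ k := by
    rw [mul_div_assoc', div_le_iff₀ hc0]; nlinarith [norm_nonneg πu, norm_nonneg πs]
  have hku : ‖πu‖ * (k / c) ≤ k := by
    rw [mul_div_assoc', div_le_iff₀ hc0]; nlinarith [norm_nonneg πu, norm_nonneg πs]
  refine ⟨k / c, by positivity, fun T w w' hw hpert ⟨C, hC⟩ => ?_⟩
  -- `Q` is positive exactly outside the cone. It satisfies `Q' ≤ a ‖πs w‖² ≤ a Q` with `a < 0`, so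
  -- once positive it grows at least linearly backwards, which contradicts boundedness.
  set Q : ℝ → ℝ := fun t => ‖πs (w t)‖ ^ 2 - η ^ 2 * ‖πu (w t)‖ ^ 2 with hQ
  set Q' : ℝ → ℝ := fun t => 2 * inner ℝ (πs (w t)) (πs (w' t)) -
    η ^ 2 * (2 * inner ℝ (πu (w t)) (πu (w' t)))
  have hQd : ∀ t ∈ Iic T, HasDerivWithinAt Q (Q' t) (Iic T) t := fun t ht =>
    (hasDerivWithinAt_norm_sq_clm πs (hw t ht)).sub
      ((hasDerivWithinAt_norm_sq_clm πu (hw t ht)).const_mul _)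
  have hQ' : ∀ t ∈ Iic T, Q' t ≤ a * ‖πs (w t)‖ ^ 2 := by
    intro t ht
    have h1 := (abs_le.1 (abs_inner_perturbation_le (hs (w t)) hks (hpert t ht))).2
    have h2 := (abs_le.1 (abs_inner_perturbation_le (hu (w t)) hku (hpert t ht))).1
    have h3 : ‖w t‖ ≤ ‖πs (w t)‖ + ‖πu (w t)‖ := by
      conv_lhs => rw [← hsum (w t)]
      exact norm_add_le _ _
    set S := ‖πs (w t)‖ with hS
    set U := ‖πu (w t)‖ with hU
    have hS0 : 0 ≤ S := norm_nonneg _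
    have hU0 : 0 ≤ U := norm_nonneg _
    have h4 : k * S * ‖w t‖ ≤ k * S * (S + U) := by gcongr
    have h5 : k * U * ‖w t‖ ≤ k * U * (S + U) := by gcongr
    have hη2 : η ^ 2 ≤ 1 := pow_le_one₀ hη.le hη1
    have h6 : η ^ 2 * (b * U ^ 2 - k * U * (S + U)) ≤ η ^ 2 * inner ℝ (πu (w t)) (πu (w' t)) := by
      gcongr; linarith
    have h7 : η ^ 2 * (k * U * (S + U)) ≤ 1 * (k * U * (S + U)) := by gcongr
    have h8 : k * (S + U) ^ 2 ≤ k * (2 * S ^ 2 + 2 * U ^ 2) := by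
      gcongr; nlinarith [sq_nonneg (S - U)]
    have h9 : 4 * k * S ^ 2 ≤ -a * S ^ 2 := by gcongr
    have h10 : 4 * k * U ^ 2 ≤ η ^ 2 * b * U ^ 2 := by gcongr
    have h11 : 0 ≤ η ^ 2 * b * U ^ 2 := by positivity
    simp only [Q']
    nlinarith
  have hQle : ∀ t, Q t ≤ ‖πs (w t)‖ ^ 2 := fun t => by
    simp only [hQ]; have : 0 ≤ η ^ 2 * ‖πu (w t)‖ ^ 2 := by positivity
    linarith
  intro t₀ ht₀
  by_contra! hlt
  have hQ0 : 0 < Q t₀ := by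
    simp only [hQ]
    have := pow_lt_pow_left₀ hlt (by positivity) two_ne_zero
    rw [mul_pow] at this
    linarith
  have hanti := antitoneOn_Iic_of_hasDerivWithinAt hQd (fun t ht =>
    (hQ' t ht).trans (mul_nonpos_of_nonpos_of_nonneg ha.le (sq_nonneg _)))
  have hsub : Iic t₀ ⊆ Iic T := Iic_subset_Iic.2 ht₀
  have hanti2 := antitoneOn_Iic_of_hasDerivWithinAt (T := t₀) (f := fun t => Q t - a * Q t₀ * t)
    (fun t ht => ((hQd t (hsub ht)).mono hsub).sub
      ((hasDerivAt_id t).const_mul (a * Q t₀)).hasDerivWithinAt) (fun t ht => by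
      have h1 := hQ' t (hsub ht)
      have h2 := (hanti (hsub ht) ht₀ ht).trans (hQle t)
      nlinarith)
  have hbd : ∀ t ∈ Iic T, Q t ≤ (‖πs‖ * C) ^ 2 := fun t ht => (hQle t).trans (by
    gcongr; exact (πs.le_opNorm _).trans (by gcongr; exact hC t ht))
  have haQ : 0 < -a * Q t₀ := by apply mul_pos _ hQ0; linarith
  -- Going back by `D` adds exactly `(‖πs‖ C)²` to the lower bound `Q t₀ > 0`, so the a priori bound
  -- on `Q` is exceeded.
  set D := (‖πs‖ * C) ^ 2 / (-a * Q t₀) with hD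
  have hD0 : 0 ≤ D := by positivity
  have hmem : t₀ - D ∈ Iic t₀ := by simp [hD0]
  have h1 := hanti2 hmem self_mem_Iic hmem
  have h2 := hbd _ (hsub hmem)
  have h3 : -a * Q t₀ * D = (‖πs‖ * C) ^ 2 := by
    rw [hD, mul_div_assoc', mul_div_cancel_left₀ _ haQ.ne']
  simp only at h1
  nlinarith

/-- Bounded backward solutions of a small perturbation of a linear equation of saddle type
decay. -/
theorem exists_tendsto_zero {A πs πu : E →L[ℝ] E} {a b : ℝ} (ha : a < 0) (hb : 0 < b)
    (hsum : ∀ w, πs w + πu w = w) (hs : ∀ w, πs (A w) = a • πs w)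
    (hu : ∀ w, πu (A w) = b • πu w) :
    ∃ κ > 0, ∀ (T : ℝ) (w w' : ℝ → E),
      (∀ t ∈ Iic T, HasDerivWithinAt w (w' t) (Iic T) t) →
      (∀ t ∈ Iic T, ‖w' t - A (w t)‖ ≤ κ * ‖w t‖) → (∃ C, ∀ t ∈ Iic T, ‖w t‖ ≤ C) →
      Tendsto w atBot (𝓝 0) := by
  obtain ⟨κ₁, hκ₁, hcone⟩ := exists_cone ha hb hsum hs hu one_pos le_rfl
  set c := ‖πu‖ + 1 with hc
  have hc0 : 0 < c := by positivity
  set κ := min κ₁ (b / 4 / c) with hκ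
  have hκu : ‖πu‖ * κ ≤ b / 4 := by
    calc ‖πu‖ * κ ≤ c * (b / 4 / c) := by
          gcongr
          · linarith
          · exact min_le_right _ _
      _ = b / 4 := by field_simp
  refine ⟨κ, lt_min hκ₁ (by positivity), fun T w w' hw hpert hC => ?_⟩
  have hS := hcone T w w' hw (fun t ht => (hpert t ht).trans (by
    gcongr; exact min_le_left _ _)) hC
  have hw2 : ∀ t ∈ Iic T, ‖w t‖ ≤ 2 * ‖πu (w t)‖ := by
    intro t ht
    have h1 := hS t ht
    have h3 : ‖w t‖ ≤ ‖πs (w t)‖ + ‖πu (w t)‖ := by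
      conv_lhs => rw [← hsum (w t)]
      exact norm_add_le _ _
    linarith
  -- Inside the cone with `η = 1` the unstable part dominates, so `(‖πu w‖²)' ≥ b ‖πu w‖²`. The
  -- factor `1/4` in `κ` leaves half of the rate `2b`.
  have hmono := monotoneOn_Iic_of_hasDerivWithinAt (T := T)
    (fun t ht => (hasDerivWithinAt_norm_sq_clm πu (hw t ht)).mul
      ((((hasDerivAt_id t).const_mul (-b)).exp).hasDerivWithinAt)) (fun t ht => by
      have h2 := (abs_le.1 (abs_inner_perturbation_le (hu (w t)) hκu (hpert t ht))).1
      have h3 := hw2 t ht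
      have h4 : b / 4 * ‖πu (w t)‖ * ‖w t‖ ≤ b / 4 * ‖πu (w t)‖ * (2 * ‖πu (w t)‖) := by gcongr
      have h5 : 0 ≤ (2 * inner ℝ (πu (w t)) (πu (w' t)) - b * ‖πu (w t)‖ ^ 2) *
          Real.exp (-b * t) := mul_nonneg (by nlinarith) (Real.exp_pos _).le
      simp only [id]
      linarith)
  have hbound : ∀ t ∈ Iic T, ‖w t‖ ^ 2 ≤ 4 * (‖πu (w T)‖ ^ 2 * Real.exp (-b * T)) *
      Real.exp (b * t) := by
    intro t ht
    have h1 := hmono ht self_mem_Iic ht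
    simp only [id, Pi.mul_apply] at h1
    have h2 : ‖w t‖ ^ 2 ≤ 4 * ‖πu (w t)‖ ^ 2 := by
      have := pow_le_pow_left₀ (norm_nonneg _) (hw2 t ht) 2
      linarith
    have h3 : Real.exp (-b * t) * Real.exp (b * t) = 1 := by rw [← Real.exp_add]; simp
    calc ‖w t‖ ^ 2 ≤ 4 * (‖πu (w t)‖ ^ 2 * (Real.exp (-b * t) * Real.exp (b * t))) := by
          rw [h3]; linarith
      _ = 4 * (‖πu (w t)‖ ^ 2 * Real.exp (-b * t)) * Real.exp (b * t) := by ring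
      _ ≤ _ := by gcongr
  have hlim : Tendsto (fun t => 4 * (‖πu (w T)‖ ^ 2 * Real.exp (-b * T)) * Real.exp (b * t))
      atBot (𝓝 0) := by
    have h1 : Tendsto (fun s : ℝ => Real.exp (b * s)) atBot (𝓝 0) :=
      Real.tendsto_exp_atBot.comp (tendsto_id.const_mul_atBot hb)
    simpa using h1.const_mul (4 * (‖πu (w T)‖ ^ 2 * Real.exp (-b * T)))
  have hsq : Tendsto (fun t => ‖w t‖ ^ 2) atBot (𝓝 0) := by
    refine squeeze_zero' (Eventually.of_forall fun t => sq_nonneg _) ?_ hlim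
    filter_upwards [eventually_le_atBot T] with t ht using hbound t ht
  rw [tendsto_zero_iff_norm_tendsto_zero]
  have := hsq.sqrt
  simpa using this

end Dichotomy

/-- A unit vector in a narrow cone about the unstable direction is expanded, and the orthogonal
direction is contracted. -/
theorem Plane.rates_of_cone {A πs πu : Plane →L[ℝ] Plane} {a b : ℝ} (hab : a < b)
    (htr : a + b = Plane.tr A) (hsum : ∀ w, πs w + πu w = w)
    (hA : ∀ w, A w = a • πs w + b • πu w) {η : ℝ} (hη : 0 < η) (hη1 : η ≤ 1 / 2) {e : Plane}
    (he : ‖e‖ = 1) (hcone : ‖πs e‖ ≤ η * ‖πu e‖) :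
    b - 2 * η * (b - a) ≤ inner ℝ e (A e) ∧
      inner ℝ (Plane.rot e) (A (Plane.rot e)) ≤ a + 2 * η * (b - a) := by
  have h1 : A e = b • e - (b - a) • πs e := by
    have h2 : b • e = b • πs e + b • πu e := by rw [← smul_add, hsum]
    rw [hA, h2]; module
  have h2 : ‖πu e‖ ≤ 1 + ‖πs e‖ := by
    have h3 : πu e = e - πs e := by rw [eq_sub_iff_add_eq, add_comm, hsum]
    rw [h3]
    exact (norm_sub_le _ _).trans (by rw [he])
  have h3 : ‖πs e‖ ≤ 2 * η := by nlinarith [norm_nonneg (πs e)]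
  have h4 : inner ℝ e (πs e) ≤ 2 * η :=
    (real_inner_le_norm _ _).trans (by rw [he, one_mul]; exact h3)
  have h5 : inner ℝ e (A e) = b - (b - a) * inner ℝ e (πs e) := by
    rw [h1, inner_sub_right, real_inner_smul_right, real_inner_smul_right,
      real_inner_self_eq_norm_sq, he]; ring
  have h6 := Plane.inner_add_inner_rot A he
  -- The tangential rate is `b - (b - a)⟨e, πs e⟩`. As the two rates sum to `a + b`, the normal one
  -- is `a + (b - a)⟨e, πs e⟩`.
  have h7 : (b - a) * inner ℝ e (πs e) ≤ (b - a) * (2 * η) := by gcongr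
  constructor <;> linarith

/-! ### The linearisation along a half-orbit in its moving frame. -/

section LinearHalfLine

theorem exists_bound_Iic {E : Type*} [NormedAddCommGroup E] {f : ℝ → E} {l : E}
    (hf : ContinuousOn f (Iic 0)) (hl : Tendsto f atBot (𝓝 l)) :
    ∃ C > 0, ∀ t ∈ Iic (0 : ℝ), ‖f t‖ ≤ C := by
  have h1 : ∀ᶠ t in atBot, ‖f t‖ < ‖l‖ + 1 := hl.norm.eventually_lt_const (by linarith)
  obtain ⟨T, hT⟩ := eventually_atBot.1 h1
  obtain ⟨C, hC⟩ := (isCompact_Icc (a := T) (b := 0)).exists_bound_of_continuousOn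
    (hf.mono Icc_subset_Iic_self)
  refine ⟨max C (‖l‖ + 1), lt_max_of_lt_right (by positivity), fun t ht => ?_⟩
  rcases le_total t T with h | h
  · exact (hT t h).le.trans (le_max_right _ _)
  · exact (hC t ⟨h, ht⟩).trans (le_max_left _ _)

/-- A rate which is eventually at most `-α` differs from one which is everywhere at most `-α` by a
bounded change of scale. -/
theorem exists_rescaling {l : ℝ → ℝ} {α T : ℝ} (hlc : ContinuousOn l (Iic 0)) (hT : T ≤ 0)
    (hl : ∀ t ∈ Iic T, l t ≤ -α) :
    ∃ (k Θ : ℝ → ℝ) (B : ℝ), ContinuousOn k (Iic 0) ∧ (∀ t ∈ Iic (0 : ℝ), k t ≤ -α) ∧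
      Θ 0 = 0 ∧ (∀ t ∈ Iic (0 : ℝ), HasDerivWithinAt Θ (l t - k t) (Iic 0) t) ∧
      ∀ t ∈ Iic (0 : ℝ), B ≤ Θ t ∧ Θ t ≤ 0 := by
  -- Truncating the rate at `-α` alters it only on `[T, 0]`, so the primitive `Θ` of the nonnegative
  -- difference is nondecreasing and constant before `T`. Hence `Θ T` is a lower bound.
  have hkc : ContinuousOn (fun t => min (l t) (-α)) (Iic 0) := hlc.inf continuousOn_const
  obtain ⟨Θ, hΘ0, hΘ⟩ := exists_primitive_Iic (hlc.sub hkc)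
  have hmono := monotoneOn_Iic_of_hasDerivWithinAt hΘ
    (fun t ht => by simp)
  have hsub : Iic T ⊆ Iic (0 : ℝ) := Iic_subset_Iic.2 hT
  have hanti := antitoneOn_Iic_of_hasDerivWithinAt (fun t ht => (hΘ t (hsub ht)).mono hsub)
    (fun t ht => by simp [min_eq_left (hl t ht)])
  refine ⟨_, Θ, Θ T, hkc, fun t _ => min_le_right _ _, hΘ0, hΘ, fun t ht => ⟨?_, ?_⟩⟩
  · rcases le_total t T with h | h
    · exact hanti h self_mem_Iic h
    · exact hmono hT ht h
  · rw [← hΘ0]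
    exact hmono ht self_mem_Iic ht

/-- Multiplying `q` by `e^{-Θ}` replaces `l` by a rate that is at most `-α` everywhere, at the cost
of a bounded factor. No condition at `0` is imposed: boundedness at `-∞` alone selects the solution.
-/
theorem exists_estimate_contracting {l : ℝ → ℝ} {α T : ℝ} (hα : 0 < α)
    (hlc : ContinuousOn l (Iic 0)) (hT : T ≤ 0) (hl : ∀ t ∈ Iic T, l t ≤ -α) :
    ∃ K > 0, (∀ (g q : ℝ → ℝ) (G C : ℝ), (∀ t ∈ Iic (0 : ℝ), |g t| ≤ G) →
        (∀ t ∈ Iic (0 : ℝ), HasDerivWithinAt q (l t * q t + g t) (Iic 0) t) →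
        (∀ t ∈ Iic (0 : ℝ), |q t| ≤ C) → ∀ t ∈ Iic (0 : ℝ), |q t| ≤ K * G) ∧
      ∀ (g : ℝ → ℝ) (G : ℝ), ContinuousOn g (Iic 0) → (∀ t ∈ Iic (0 : ℝ), |g t| ≤ G) →
        ∃ (q : ℝ → ℝ) (C : ℝ), (∀ t ∈ Iic (0 : ℝ), |q t| ≤ C) ∧
          ∀ t ∈ Iic (0 : ℝ), HasDerivWithinAt q (l t * q t + g t) (Iic 0) t := by
  obtain ⟨k, Θ, B, hkc, hk, -, hΘ, hB⟩ := exists_rescaling hlc hT hl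
  have hΘc : ContinuousOn Θ (Iic 0) := fun t ht => (hΘ t ht).continuousWithinAt
  have hinv : ∀ t, Real.exp (-Θ t) * Real.exp (Θ t) = 1 := fun t => by
    rw [← Real.exp_add]; simp
  have hgE : ∀ (g : ℝ → ℝ) (G : ℝ), (∀ t ∈ Iic (0 : ℝ), |g t| ≤ G) →
      ∀ t ∈ Iic (0 : ℝ), |g t * Real.exp (-Θ t)| ≤ G * Real.exp (-B) := by
    intro g G hg t ht
    have hG : 0 ≤ G := (abs_nonneg _).trans (hg t ht)
    rw [abs_mul, abs_of_pos (Real.exp_pos _)]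
    gcongr
    · exact hg t ht
    · exact (hB t ht).1
  refine ⟨Real.exp (-B) / α, by positivity, fun g q G C hg hq hC t ht => ?_, fun g G hgc hg => ?_⟩
  · have h1 := abs_le_of_contracting (q := fun t => q t * Real.exp (-Θ t))
      (g := fun t => g t * Real.exp (-Θ t)) (C := C * Real.exp (-B)) hα hkc hk (hgE g G hg)
      (fun t ht => ((hq t ht).mul (hΘ t ht).neg.exp).congr_deriv (by simp only [Pi.neg_apply]; ring))
      (hgE q C hC) ht
    rw [abs_mul, abs_of_pos (Real.exp_pos _)] at h1
    have h2 : 1 ≤ Real.exp (-Θ t) := Real.one_le_exp (by linarith [(hB t ht).2])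
    calc |q t| ≤ |q t| * Real.exp (-Θ t) := le_mul_of_one_le_right (abs_nonneg _) h2
      _ ≤ _ := h1
      _ = _ := by ring
  · obtain ⟨q, C, hC, hq⟩ := exists_bounded_of_contracting hα hkc hk
      (hgc.mul (Real.continuous_exp.comp_continuousOn hΘc.neg)) (hgE g G hg)
    refine ⟨fun t => q t * Real.exp (Θ t), C, fun t ht => ?_, fun t ht => ?_⟩
    · rw [abs_mul, abs_of_pos (Real.exp_pos _)]
      refine le_trans ?_ (hC t ht)
      exact mul_le_of_le_one_right (abs_nonneg _) (Real.exp_le_one_iff.2 (hB t ht).2)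
    · refine ((hq t ht).mul (hΘ t ht).exp).congr_deriv ?_
      change (k t * q t + g t * Real.exp (-Θ t)) * _ + _ = _
      linear_combination g t * hinv t

/-- The same rescaling, applied to `-l`, reduces to a rate that is uniformly expanding. The value at
`0` remains free and is fixed later by the boundary condition on the section. -/
theorem exists_estimate_expanding {l : ℝ → ℝ} {α T : ℝ} (hα : 0 < α)
    (hlc : ContinuousOn l (Iic 0)) (hT : T ≤ 0) (hl : ∀ t ∈ Iic T, α ≤ l t) :
    ∃ K > 0, ∀ (g p : ℝ → ℝ) (G : ℝ), (∀ t ∈ Iic (0 : ℝ), |g t| ≤ G) →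
        (∀ t ∈ Iic (0 : ℝ), HasDerivWithinAt p (l t * p t + g t) (Iic 0) t) →
        ∀ t ∈ Iic (0 : ℝ), |p t| ≤ K * (|p 0| + G) := by
  obtain ⟨k, Θ, B, hkc, hk, hΘ0, hΘ, hB⟩ :=
    exists_rescaling hlc.neg hT (fun t ht => neg_le_neg (hl t ht))
  refine ⟨Real.exp (-B) * (1 + 1 / α), by positivity, fun g p G hg hp t ht => ?_⟩
  have hG : 0 ≤ G := (abs_nonneg _).trans (hg t ht)
  have h1 := abs_le_of_expanding (p := fun t => p t * Real.exp (Θ t)) (G := G)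
      (g := fun t => g t * Real.exp (Θ t)) hα hkc.neg (fun t ht => le_neg_of_le_neg (hk t ht))
      (fun t ht => by
        rw [abs_mul, abs_of_pos (Real.exp_pos _)]
        refine le_trans ?_ (hg t ht)
        exact mul_le_of_le_one_right (abs_nonneg _) (Real.exp_le_one_iff.2 (hB t ht).2))
      (fun t ht => ((hp t ht).mul (hΘ t ht).exp).congr_deriv (by simp; ring)) ht
  simp only [hΘ0, Real.exp_zero, mul_one] at h1
  rw [abs_mul, abs_of_pos (Real.exp_pos _)] at h1
  have h2 : 1 ≤ Real.exp (-B) * Real.exp (Θ t) := by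
    rw [← Real.exp_add]; exact Real.one_le_exp (by linarith [(hB t ht).1])
  calc |p t| ≤ |p t| * (Real.exp (-B) * Real.exp (Θ t)) :=
        le_mul_of_one_le_right (abs_nonneg _) h2
    _ = Real.exp (-B) * (|p t| * Real.exp (Θ t)) := by ring
    _ ≤ Real.exp (-B) * (|p 0| + G / α) := by gcongr
    _ ≤ Real.exp (-B) * ((1 + 1 / α) * (|p 0| + G)) := by
        gcongr
        have : 0 ≤ 1 / α * |p 0| := by positivity
        have : G / α = 1 / α * G := by ring
        nlinarith
    _ = _ := by ring

/-- `‖φ‖² e^{-2Mt}` is nonincreasing, so a zero at an earlier time would force `φ 0 = 0`. -/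
theorem ne_zero_of_linear {A : ℝ → Plane →L[ℝ] Plane} {φ : ℝ → Plane} {M : ℝ}
    (hM : ∀ t ∈ Iic (0 : ℝ), ‖A t‖ ≤ M)
    (hφ : ∀ t ∈ Iic (0 : ℝ), HasDerivWithinAt φ (A t (φ t)) (Iic 0) t) (hφ0 : φ 0 ≠ 0) :
    ∀ t ∈ Iic (0 : ℝ), φ t ≠ 0 := by
  intro t ht h0
  have hanti := antitoneOn_Iic_of_hasDerivWithinAt (T := 0)
    (fun t ht => (hφ t ht).norm_sq.mul
      ((((hasDerivAt_id t).const_mul (-2 * M)).exp).hasDerivWithinAt)) (fun t ht => by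
      have h1 : inner ℝ (φ t) (A t (φ t)) ≤ M * ‖φ t‖ ^ 2 := by
        calc inner ℝ (φ t) (A t (φ t)) ≤ ‖φ t‖ * ‖A t (φ t)‖ := real_inner_le_norm _ _
          _ ≤ ‖φ t‖ * (M * ‖φ t‖) := by
            gcongr; exact (A t).le_of_opNorm_le (hM t ht) _
          _ = _ := by ring
      have h2 := mul_nonneg (sub_nonneg.2 h1) (Real.exp_pos (-2 * M * t)).le
      simp only [id]
      linarith)
  have h1 := hanti ht self_mem_Iic ht
  simp [h0] at h1
  exact hφ0 h1

/-- The frame moving with the direction of a solution of a planar linear equation. -/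
theorem hasDerivWithinAt_normalised {A : Plane →L[ℝ] Plane} {φ : ℝ → Plane} {s : Set ℝ} {t : ℝ}
    (hφ : HasDerivWithinAt φ (A (φ t)) s t) (h0 : φ t ≠ 0) :
    HasDerivWithinAt (fun t => normalised (φ t))
      (inner ℝ (Plane.rot (normalised (φ t))) (A (normalised (φ t))) •
        Plane.rot (normalised (φ t))) s t := by
  have hn : ‖φ t‖ ≠ 0 := norm_ne_zero_iff.2 h0
  have he : ‖normalised (φ t)‖ = 1 := by
    rw [normalised, norm_smul, norm_inv, norm_norm, inv_mul_cancel₀ hn]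
  have h1 : HasDerivWithinAt (fun t => ‖φ t‖) (inner ℝ (φ t) (A (φ t)) / ‖φ t‖) s t := by
    have := hφ.norm_sq.sqrt (pow_ne_zero 2 hn)
    simp only [Real.sqrt_sq (norm_nonneg _)] at this
    refine this.congr_deriv ?_
    field_simp
  refine ((h1.inv hn).smul hφ).congr_deriv ?_
  have h2 := Plane.eq_frame he (A (normalised (φ t)))
  have h3 : inner ℝ (Plane.rot (normalised (φ t))) (A (normalised (φ t))) •
      Plane.rot (normalised (φ t)) = A (normalised (φ t)) -
        inner ℝ (normalised (φ t)) (A (normalised (φ t))) • normalised (φ t) :=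
    eq_sub_of_add_eq' h2.symm
  rw [h3]
  simp only [normalised, map_smul, real_inner_smul_left, real_inner_smul_right, smul_smul]
  have h4 : -(inner ℝ (φ t) (A (φ t)) / ‖φ t‖) / ‖φ t‖ ^ 2 =
      -(‖φ t‖⁻¹ * (‖φ t‖⁻¹ * inner ℝ (φ t) (A (φ t))) * ‖φ t‖⁻¹) := by field_simp
  rw [h4]
  module

theorem norm_normalised {w : Plane} (h : w ≠ 0) : ‖normalised w‖ = 1 := by
  rw [normalised, norm_smul, norm_inv, norm_norm, inv_mul_cancel₀ (norm_ne_zero_iff.2 h)]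

theorem Plane.rot_rot (w : Plane) : Plane.rot (Plane.rot w) = -w :=
  Plane.ext_coord (by simp) (by simp)

/-- Along a bounded backward solution of a linear equation that is asymptotically of saddle type,
the tangent direction is eventually expanded and the normal direction contracted. -/
theorem exists_rates {A : ℝ → Plane →L[ℝ] Plane} {A₀ : Plane →L[ℝ] Plane}
    (hA : Tendsto A atBot (𝓝 A₀)) (hdet : Plane.determinant A₀ < 0) {φ : ℝ → Plane} {C : ℝ}
    (hφ : ∀ t ∈ Iic (0 : ℝ), HasDerivWithinAt φ (A t (φ t)) (Iic 0) t)
    (hφC : ∀ t ∈ Iic (0 : ℝ), ‖φ t‖ ≤ C) (hne : ∀ t ∈ Iic (0 : ℝ), φ t ≠ 0) :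
    ∃ α > 0, ∃ T ≤ 0, ∀ t ∈ Iic T,
      α ≤ inner ℝ (normalised (φ t)) (A t (normalised (φ t))) ∧
      inner ℝ (Plane.rot (normalised (φ t))) (A t (Plane.rot (normalised (φ t)))) ≤ -α := by
  obtain ⟨a, b, πs, πu, ha, hb, htr, hsum, hs, hu, hAs⟩ := Plane.exists_splitting hdet
  have hab : 0 < b - a := by linarith
  set β := min (-a) b with hβ
  have hβ0 : 0 < β := lt_min (by linarith) hb
  have hβa : β ≤ -a := min_le_left _ _
  have hβb : β ≤ b := min_le_right _ _
  -- This makes the cone error `2η(b - a)` equal to `β/4`. Together with `‖A t - A₀‖ ≤ β/4` it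
  -- leaves a rate of at least `β/2`.
  set η := β / (8 * (b - a)) with hη
  have hη0 : 0 < η := by positivity
  have hη1 : η ≤ 1 / 2 := by
    rw [hη, div_le_iff₀ (by positivity)]; linarith
  have hηb : 2 * η * (b - a) = β / 4 := by rw [hη]; field_simp; norm_num
  obtain ⟨κ, hκ, hcone⟩ := exists_cone ha hb hsum hs hu hη0 (hη1.trans (by norm_num))
  have hev : ∀ᶠ t in atBot, ‖A t - A₀‖ < min κ (β / 4) := by
    have := (tendsto_iff_norm_sub_tendsto_zero.1 hA)
    exact this.eventually_lt_const (lt_min hκ (by positivity))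
  obtain ⟨T, hT⟩ := eventually_atBot.1 hev
  set T' := min T 0
  have hT'0 : T' ≤ 0 := min_le_right _ _
  have hsub : Iic T' ⊆ Iic (0 : ℝ) := Iic_subset_Iic.2 hT'0
  have hclose : ∀ t ∈ Iic T', ‖A t - A₀‖ ≤ κ ∧ ‖A t - A₀‖ ≤ β / 4 := by
    intro t ht
    have := hT t (le_trans ht (min_le_left _ _))
    exact ⟨(this.trans_le (min_le_left _ _)).le, (this.trans_le (min_le_right _ _)).le⟩
  have hc := hcone T' φ (fun t => A t (φ t)) (fun t ht => (hφ t (hsub ht)).mono hsub)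
    (fun t ht => by
      rw [← sub_apply]
      exact (A t - A₀).le_of_opNorm_le (hclose t ht).1 _) ⟨C, fun t ht => hφC t (hsub ht)⟩
  refine ⟨β / 2, by positivity, T', hT'0, fun t ht => ?_⟩
  have he : ‖normalised (φ t)‖ = 1 := norm_normalised (hne t (hsub ht))
  have hce : ‖πs (normalised (φ t))‖ ≤ η * ‖πu (normalised (φ t))‖ := by
    simp only [normalised, map_smul, norm_smul]
    have := mul_le_mul_of_nonneg_left (hc t ht) (norm_nonneg (‖φ t‖⁻¹))
    linarith
  obtain ⟨h1, h2⟩ := Plane.rates_of_cone (by linarith) htr hsum hAs hη0 hη1 he hce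
  have hpert : ∀ v : Plane, ‖v‖ = 1 → |inner ℝ v (A t v) - inner ℝ v (A₀ v)| ≤ β / 4 := by
    intro v hv
    rw [← inner_sub_right, ← sub_apply]
    refine (abs_real_inner_le_norm _ _).trans ?_
    rw [hv, one_mul]
    refine ((A t - A₀).le_opNorm v).trans ?_
    rw [hv, mul_one]
    exact (hclose t ht).2
  have h3 := abs_le.1 (hpert _ he)
  have h4 := abs_le.1 (hpert _ ((Plane.norm_rot _).trans he))
  constructor <;> linarith [h3.1, h4.2]

/-- The boundary value problem for the linearisation along a transversal orbit emanating from a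
saddle: it has a bounded solution, and bounded solutions are controlled by the forcing term. -/
theorem exists_estimate_linear {A : ℝ → Plane →L[ℝ] Plane} {A₀ : Plane →L[ℝ] Plane}
    (hAc : ContinuousOn A (Iic 0)) (hA : Tendsto A atBot (𝓝 A₀))
    (hdet : Plane.determinant A₀ < 0) {φ : ℝ → Plane} {C₀ : ℝ}
    (hφ : ∀ t ∈ Iic (0 : ℝ), HasDerivWithinAt φ (A t (φ t)) (Iic 0) t)
    (hφC : ∀ t ∈ Iic (0 : ℝ), ‖φ t‖ ≤ C₀) (htrans : φ 0 0 ≠ 0) :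
    ∃ K > 0,
      (∀ (g y : ℝ → Plane) (G C : ℝ), (∀ t ∈ Iic (0 : ℝ), ‖g t‖ ≤ G) →
        (∀ t ∈ Iic (0 : ℝ), HasDerivWithinAt y (A t (y t) + g t) (Iic 0) t) →
        (∀ t ∈ Iic (0 : ℝ), ‖y t‖ ≤ C) → y 0 0 = 0 → ∀ t ∈ Iic (0 : ℝ), ‖y t‖ ≤ K * G) ∧
      ∀ (g : ℝ → Plane) (G : ℝ), ContinuousOn g (Iic 0) → (∀ t ∈ Iic (0 : ℝ), ‖g t‖ ≤ G) →
        ∃ (y : ℝ → Plane) (C : ℝ), y 0 0 = 0 ∧ (∀ t ∈ Iic (0 : ℝ), ‖y t‖ ≤ C) ∧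
          ∀ t ∈ Iic (0 : ℝ), HasDerivWithinAt y (A t (y t) + g t) (Iic 0) t := by
  obtain ⟨M, hM0, hM⟩ := exists_bound_Iic hAc hA
  have hφ0 : φ 0 ≠ 0 := fun h => htrans (by rw [h]; rfl)
  have hne := ne_zero_of_linear hM hφ hφ0
  obtain ⟨α, hα, T, hT, hrates⟩ := exists_rates hA hdet hφ hφC hne
  set e : ℝ → Plane := fun t => normalised (φ t) with hedef
  set n : ℝ → Plane := fun t => Plane.rot (e t) with hndef
  have he1 : ∀ t ∈ Iic (0 : ℝ), ‖e t‖ = 1 := fun t ht => norm_normalised (hne t ht)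
  have hn1 : ∀ t ∈ Iic (0 : ℝ), ‖n t‖ = 1 := fun t ht => (Plane.norm_rot _).trans (he1 t ht)
  have hed : ∀ t ∈ Iic (0 : ℝ), HasDerivWithinAt e (inner ℝ (n t) (A t (e t)) • n t) (Iic 0) t :=
    fun t ht => hasDerivWithinAt_normalised (hφ t ht) (hne t ht)
  have hnd : ∀ t ∈ Iic (0 : ℝ),
      HasDerivWithinAt n (-(inner ℝ (n t) (A t (e t)) • e t)) (Iic 0) t := by
    intro t ht
    refine (Plane.rot.hasFDerivAt.comp_hasDerivWithinAt t (hed t ht)).congr_deriv ?_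
    rw [map_smul, hndef, Plane.rot_rot, smul_neg]
  have hec : ContinuousOn e (Iic 0) := fun t ht => (hed t ht).continuousWithinAt
  have hnc : ContinuousOn n (Iic 0) := fun t ht => (hnd t ht).continuousWithinAt
  have hframe : ∀ t ∈ Iic (0 : ℝ), ∀ w : Plane,
      w = inner ℝ (e t) w • e t + inner ℝ (n t) w • n t := fun t ht w =>
    Plane.eq_frame (he1 t ht) w
  -- In the frame `(e, n)` the system is triangular because the line spanned by `φ` is invariant.
  -- The normal coordinate `q` evolves by itself with rate `ln`, and enters the tangential
  -- coordinate `p`, of rate `le`, through the coupling `f`.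
  set le : ℝ → ℝ := fun t => inner ℝ (e t) (A t (e t)) with hle
  set ln : ℝ → ℝ := fun t => inner ℝ (n t) (A t (n t)) with hln
  set f : ℝ → ℝ := fun t => inner ℝ (e t) (A t (n t)) + inner ℝ (n t) (A t (e t)) with hf
  have hlec : ContinuousOn le (Iic 0) := hec.inner (hAc.clm_apply hec)
  have hlnc : ContinuousOn ln (Iic 0) := hnc.inner (hAc.clm_apply hnc)
  have hfc : ContinuousOn f (Iic 0) :=
    (hec.inner (hAc.clm_apply hnc)).add (hnc.inner (hAc.clm_apply hec))
  obtain ⟨Kq, hKq, hq1, hq2⟩ :=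
    exists_estimate_contracting hα hlnc hT (fun t ht => (hrates t ht).2)
  obtain ⟨Kp, hKp, hp1⟩ :=
    exists_estimate_expanding hα hlec hT (fun t ht => (hrates t ht).1)
  have hbil : ∀ t ∈ Iic (0 : ℝ), ∀ v w : Plane, ‖v‖ = 1 → ‖w‖ = 1 →
      |inner ℝ v (A t w)| ≤ M := by
    intro t ht v w hv hw
    refine (abs_real_inner_le_norm _ _).trans ?_
    rw [hv, one_mul]
    simpa [hw] using (A t).le_of_opNorm_le (hM t ht) w
  have hfM : ∀ t ∈ Iic (0 : ℝ), |f t| ≤ 2 * M := by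
    intro t ht
    refine (abs_add_le _ _).trans ?_
    have h1 := hbil t ht _ _ (he1 t ht) (hn1 t ht)
    have h2 := hbil t ht _ _ (hn1 t ht) (he1 t ht)
    linarith
  have hunit : ∀ (v w : Plane) (G : ℝ), ‖v‖ = 1 → ‖w‖ ≤ G → |inner ℝ v w| ≤ G := by
    intro v w G hv hw
    refine (abs_real_inner_le_norm _ _).trans ?_
    rwa [hv, one_mul]
  have h0 : (0 : ℝ) ∈ Iic (0 : ℝ) := self_mem_Iic
  have he00 : e 0 0 ≠ 0 := by
    simp only [hedef, normalised, PiLp.smul_apply, smul_eq_mul]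
    exact mul_ne_zero (inv_ne_zero (norm_ne_zero_iff.2 hφ0)) htrans
  have he01 : |e 0 1| ≤ 1 := by
    rw [← he1 0 h0, ← Real.norm_eq_abs]; exact PiLp.norm_apply_le _ _
  refine ⟨Kq + Kp * (Kq / |e 0 0| + (2 * M * Kq + 1)), by positivity, ?_, ?_⟩
  · intro g y G C hg hy hC hy0 t ht
    set p : ℝ → ℝ := fun t => inner ℝ (e t) (y t) with hp
    set q : ℝ → ℝ := fun t => inner ℝ (n t) (y t) with hq
    have hAy : ∀ t ∈ Iic (0 : ℝ), A t (y t) = p t • A t (e t) + q t • A t (n t) := by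
      intro t ht
      conv_lhs => rw [hframe t ht (y t)]
      rw [map_add, map_smul, map_smul]
    have hqd : ∀ t ∈ Iic (0 : ℝ),
        HasDerivWithinAt q (ln t * q t + inner ℝ (n t) (g t)) (Iic 0) t := by
      intro t ht
      refine ((hnd t ht).inner ℝ (hy t ht)).congr_deriv ?_
      rw [hAy t ht]
      simp only [inner_add_right, real_inner_smul_right, inner_neg_left, real_inner_smul_left,
        hln, hp, hq]
      ring
    have hpd : ∀ t ∈ Iic (0 : ℝ),
        HasDerivWithinAt p (le t * p t + (f t * q t + inner ℝ (e t) (g t))) (Iic 0) t := by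
      intro t ht
      refine ((hed t ht).inner ℝ (hy t ht)).congr_deriv ?_
      rw [hAy t ht]
      simp only [inner_add_right, real_inner_smul_right, real_inner_smul_left,
        hle, hp, hq, hf]
      ring
    have hqK := hq1 _ q G C (fun t ht => hunit _ _ _ (hn1 t ht) (hg t ht)) hqd
      (fun t ht => hunit _ _ _ (hn1 t ht) (hC t ht))
    have hpK := hp1 _ p (2 * M * (Kq * G) + G) (fun t ht => by
      refine (abs_add_le _ _).trans (add_le_add ?_ (hunit _ _ _ (he1 t ht) (hg t ht)))
      rw [abs_mul]
      exact mul_le_mul (hfM t ht) (hqK t ht) (abs_nonneg _) (by positivity)) hpd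
    -- On the section `p 0 · e₁ + q 0 · n₁ = 0`. Transversality means `e₁ ≠ 0`, so `p 0` is
    -- controlled by `q 0`.
    have hp0 : |p 0| ≤ Kq / |e 0 0| * G := by
      have h1 : p 0 * e 0 0 = q 0 * e 0 1 := by
        have := congrArg (fun w : Plane => w 0) (hframe 0 h0 (y 0))
        simp only [hy0, PiLp.add_apply, PiLp.smul_apply, smul_eq_mul, hndef,
          Plane.rot_zero] at this
        simp only [hp, hq, hndef]
        linarith
      have h2 : |p 0| * |e 0 0| ≤ Kq * G := by
        rw [← abs_mul, h1, abs_mul]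
        calc |q 0| * |e 0 1| ≤ |q 0| * 1 := by gcongr
          _ ≤ _ := by rw [mul_one]; exact hqK 0 h0
      rw [div_mul_eq_mul_div, le_div_iff₀ (abs_pos.2 he00)]
      exact h2
    calc ‖y t‖ ≤ |p t| + |q t| := by
          conv_lhs => rw [hframe t ht (y t)]
          refine (norm_add_le _ _).trans ?_
          rw [norm_smul, norm_smul, he1 t ht, hn1 t ht, mul_one, mul_one]
          rfl
      _ ≤ Kp * (|p 0| + (2 * M * (Kq * G) + G)) + Kq * G := add_le_add (hpK t ht) (hqK t ht)
      _ ≤ Kp * (Kq / |e 0 0| * G + (2 * M * (Kq * G) + G)) + Kq * G := by gcongr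
      _ = _ := by ring
  · intro g G hgc hg
    obtain ⟨q, Cq, hqC, hqd⟩ := hq2 _ G (hnc.inner hgc)
      (fun t ht => hunit _ _ _ (hn1 t ht) (hg t ht))
    have hqc : ContinuousOn q (Iic 0) := fun t ht => (hqd t ht).continuousWithinAt
    -- The final value of `p` is the one that makes the first coordinate of `p e + q n` vanish at
    -- time `0`, since `n₁ = -e₂`.
    obtain ⟨p, hp0, hpd⟩ := exists_solution_linear hlec ((hfc.mul hqc).add (hec.inner hgc))
      (q 0 * e 0 1 / e 0 0)
    have hpK := hp1 _ p (2 * M * Cq + G) (fun t ht => by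
      refine (abs_add_le _ _).trans (add_le_add ?_ (hunit _ _ _ (he1 t ht) (hg t ht)))
      change |f t * q t| ≤ _
      rw [abs_mul]
      exact mul_le_mul (hfM t ht) (hqC t ht) (abs_nonneg _) (by positivity)) hpd
    refine ⟨fun t => p t • e t + q t • n t, Kp * (|p 0| + (2 * M * Cq + G)) + Cq, ?_,
      fun t ht => ?_, fun t ht => ?_⟩
    · simp only [PiLp.add_apply, PiLp.smul_apply, smul_eq_mul, hndef, Plane.rot_zero, hp0]
      field_simp
      ring
    · refine (norm_add_le _ _).trans ?_
      rw [norm_smul, norm_smul, he1 t ht, hn1 t ht, mul_one, mul_one]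
      exact add_le_add (hpK t ht) (hqC t ht)
    · refine (((hpd t ht).smul (hed t ht)).add ((hqd t ht).smul (hnd t ht))).congr_deriv ?_
      have hg' := hframe t ht (g t)
      have hAe := hframe t ht (A t (e t))
      have hAn := hframe t ht (A t (n t))
      have hR : A t (p t • e t + q t • n t) + g t =
          p t • (inner ℝ (e t) (A t (e t)) • e t + inner ℝ (n t) (A t (e t)) • n t) +
          q t • (inner ℝ (e t) (A t (n t)) • e t + inner ℝ (n t) (A t (n t)) • n t) +
          (inner ℝ (e t) (g t) • e t + inner ℝ (n t) (g t) • n t) := by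
        rw [map_add, map_smul, map_smul, ← hAe, ← hAn, ← hg']
      rw [hR]
      simp only [Pi.add_apply, Pi.mul_apply, hle, hln, hf]
      module

end LinearHalfLine

/-! ### Strict differentiability, uniformly along compact sets. -/

section UniformDifferentiability

variable {E F G : Type*} [NormedAddCommGroup E] [NormedSpace ℝ E] [NormedAddCommGroup F]
  [NormedSpace ℝ F] [NormedAddCommGroup G] [NormedSpace ℝ G]

/-- Strict differentiability is uniform along compact sets of points at which the derivative
depends continuously on the point. -/
theorem IsCompact.exists_uniform_strict {H : E × F → G} {D : E → E × F →L[ℝ] G} {K : Set E}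
    {μ₀ : F} (hK : IsCompact K) (hD : ContinuousOn D K)
    (hs : ∀ k ∈ K, HasStrictFDerivAt H (D k) (k, μ₀)) {η : ℝ} (hη : 0 < η) :
    ∃ r > 0, ∀ k ∈ K, ∀ q₁ ∈ Metric.ball (k, μ₀) r, ∀ q₂ ∈ Metric.ball (k, μ₀) r,
      ‖H q₁ - H q₂ - D k (q₁ - q₂)‖ ≤ η * ‖q₁ - q₂‖ := by
  suffices h : ∃ r > 0, ∀ k ∈ K, k ∈ K → ∀ q₁ ∈ Metric.ball (k, μ₀) r,
      ∀ q₂ ∈ Metric.ball (k, μ₀) r, ‖H q₁ - H q₂ - D k (q₁ - q₂)‖ ≤ η * ‖q₁ - q₂‖ by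
    obtain ⟨r, hr, h⟩ := h
    exact ⟨r, hr, fun k hk => h k hk hk⟩
  refine hK.induction_on (p := fun s => ∃ r > 0, ∀ k ∈ s, k ∈ K → ∀ q₁ ∈ Metric.ball (k, μ₀) r,
      ∀ q₂ ∈ Metric.ball (k, μ₀) r, ‖H q₁ - H q₂ - D k (q₁ - q₂)‖ ≤ η * ‖q₁ - q₂‖)
    ⟨1, one_pos, fun k hk => hk.elim⟩ ?_ ?_ ?_
  · rintro s t hst ⟨r, hr, h⟩
    exact ⟨r, hr, fun k hk => h k (hst hk)⟩
  · rintro s t ⟨r₁, hr₁, h₁⟩ ⟨r₂, hr₂, h₂⟩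
    refine ⟨min r₁ r₂, lt_min hr₁ hr₂, fun k hk hkK q₁ hq₁ q₂ hq₂ => ?_⟩
    rcases hk with hk | hk
    · exact h₁ k hk hkK q₁ (Metric.ball_subset_ball (min_le_left _ _) hq₁) q₂
        (Metric.ball_subset_ball (min_le_left _ _) hq₂)
    · exact h₂ k hk hkK q₁ (Metric.ball_subset_ball (min_le_right _ _) hq₁) q₂
        (Metric.ball_subset_ball (min_le_right _ _) hq₂)
  · intro k₀ hk₀
    have h1 := (hs k₀ hk₀).isLittleO.def (half_pos hη)
    obtain ⟨r, hr, h2⟩ := Metric.eventually_nhds_iff_ball.1 h1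
    have h3 : ∀ᶠ k in 𝓝[K] k₀, dist (D k) (D k₀) < η / 2 :=
      (hD k₀ hk₀).eventually (Metric.ball_mem_nhds _ (half_pos hη))
    have h4 : ∀ᶠ k in 𝓝[K] k₀, dist k k₀ < r / 2 :=
      nhdsWithin_le_nhds (Metric.ball_mem_nhds _ (half_pos hr))
    refine ⟨{k | dist (D k) (D k₀) < η / 2 ∧ dist k k₀ < r / 2}, h3.and h4, r / 2, half_pos hr, ?_⟩
    rintro k ⟨hk1, hk2⟩ - q₁ hq₁ q₂ hq₂
    have hsub : ∀ q ∈ Metric.ball (k, μ₀) (r / 2), dist q (k₀, μ₀) < r := by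
      intro q hq
      have h5 : dist (k, μ₀) (k₀, μ₀) < r / 2 := by
        rw [Prod.dist_eq, dist_self]; exact max_lt hk2 (half_pos hr)
      calc dist q (k₀, μ₀) ≤ dist q (k, μ₀) + dist (k, μ₀) (k₀, μ₀) := dist_triangle _ _ _
        _ < r / 2 + r / 2 := add_lt_add hq h5
        _ = r := by ring
    have h6 := h2 (q₁, q₂) (by
      rw [Metric.mem_ball, Prod.dist_eq]; exact max_lt (hsub q₁ hq₁) (hsub q₂ hq₂))
    simp only at h6
    have h7 : ‖(D k - D k₀) (q₁ - q₂)‖ ≤ η / 2 * ‖q₁ - q₂‖ :=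
      (D k - D k₀).le_of_opNorm_le (by rw [← dist_eq_norm]; exact hk1.le) _
    calc ‖H q₁ - H q₂ - D k (q₁ - q₂)‖
        = ‖(H q₁ - H q₂ - D k₀ (q₁ - q₂)) - (D k - D k₀) (q₁ - q₂)‖ := by
          rw [sub_apply]; congr 1; abel
      _ ≤ η / 2 * ‖q₁ - q₂‖ + η / 2 * ‖q₁ - q₂‖ := (norm_sub_le _ _).trans (add_le_add h6 h7)
      _ = η * ‖q₁ - q₂‖ := by ring

/-- The bound makes `H` Lipschitz on the ball with constant `η + ‖L‖`. This gives continuity of `h`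
at parameters other than `μ₀`, where differentiability is not among the assumptions on the orbit. -/
theorem continuousAt_of_strict_bound {H : E → G} {L : E →L[ℝ] G} {z q : E} {r η : ℝ}
    (hU : ∀ q₁ ∈ Metric.ball z r, ∀ q₂ ∈ Metric.ball z r,
      ‖H q₁ - H q₂ - L (q₁ - q₂)‖ ≤ η * ‖q₁ - q₂‖) (hq : q ∈ Metric.ball z r) :
    ContinuousAt H q := by
  rw [ContinuousAt, tendsto_iff_norm_sub_tendsto_zero]
  have hlim : Tendsto (fun q₁ => (η + ‖L‖) * ‖q₁ - q‖) (𝓝 q) (𝓝 0) := by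
    have : Continuous fun q₁ => (η + ‖L‖) * ‖q₁ - q‖ := by fun_prop
    simpa using this.tendsto q
  refine squeeze_zero' (Eventually.of_forall fun _ => norm_nonneg _) ?_ hlim
  filter_upwards [Metric.isOpen_ball.mem_nhds hq] with q₁ hq₁
  calc ‖H q₁ - H q‖ = ‖(H q₁ - H q - L (q₁ - q)) + L (q₁ - q)‖ := by congr 1; abel
    _ ≤ η * ‖q₁ - q‖ + ‖L‖ * ‖q₁ - q‖ :=
      (norm_add_le _ _).trans (add_le_add (hU _ hq₁ _ hq) (L.le_opNorm _))
    _ = _ := by ring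

theorem ContDiffAt.hasFDerivAt_left {h : E → F → G} {x : E} {μ : F}
    (hs : ContDiffAt ℝ 1 (fun q : E × F => h q.1 q.2) (x, μ)) :
    HasFDerivAt (fun x => h x μ) (fderiv ℝ (fun q : E × F => h q.1 q.2) (x, μ) ∘L
      ContinuousLinearMap.inl ℝ E F) x :=
  HasFDerivAt.comp (f := fun x => (x, μ)) x (hs.differentiableAt one_ne_zero).hasFDerivAt
    (hasFDerivAt_prodMk_left x μ)

theorem ContDiffAt.hasFDerivAt_right {h : E → F → G} {x : E} {μ : F}
    (hs : ContDiffAt ℝ 1 (fun q : E × F => h q.1 q.2) (x, μ)) :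
    HasFDerivAt (fun μ => h x μ) (fderiv ℝ (fun q : E × F => h q.1 q.2) (x, μ) ∘L
      ContinuousLinearMap.inr ℝ E F) μ :=
  HasFDerivAt.comp (f := fun μ => (x, μ)) μ (hs.differentiableAt one_ne_zero).hasFDerivAt
    (hasFDerivAt_prodMk_right x μ)

end UniformDifferentiability

/-! ### Persistence of saddles by the implicit function theorem. -/

section SaddleContinuation

theorem Plane.isInvertible_of_determinant {A : Plane →L[ℝ] Plane} (h : Plane.determinant A ≠ 0) :
    A.IsInvertible := by
  have hinj : Function.Injective (A : Plane →ₗ[ℝ] Plane) := by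
    rw [← LinearMap.ker_eq_bot, LinearMap.ker_eq_bot']
    intro w hw
    have h0 : A w 0 = 0 := by
      change (A : Plane →ₗ[ℝ] Plane) w 0 = 0; rw [hw]; rfl
    have h1 : A w 1 = 0 := by
      change (A : Plane →ₗ[ℝ] Plane) w 1 = 0; rw [hw]; rfl
    rw [Plane.apply_eq] at h0 h1
    unfold Plane.determinant at h
    refine Plane.ext_coord (mul_left_cancel₀ h ?_) (mul_left_cancel₀ h ?_)
    · simp only [PiLp.zero_apply]
      linear_combination Plane.entry A 1 1 * h0 - Plane.entry A 0 1 * h1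
    · simp only [PiLp.zero_apply]
      linear_combination Plane.entry A 0 0 * h1 - Plane.entry A 1 0 * h0
  exact ⟨(LinearEquiv.ofInjectiveEndo _ hinj).toContinuousLinearEquiv, by ext; rfl⟩

theorem Plane.continuous_determinant : Continuous Plane.determinant := by
  unfold Plane.determinant Plane.entry
  fun_prop

/-- Saddles persist under perturbation of the vector field. -/
theorem exists_saddleContinuation {m : ℕ} {h : Plane → Param m → Plane} {μ₀ : Param m} {p : Plane}
    (hs : ContDiffAt ℝ 1 (fun q : Plane × Param m => h q.1 q.2) (p, μ₀))
    (hp : IsSaddle (fun x => h x μ₀) p) : ∃ P, IsSaddleContinuation h μ₀ p P := by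
  obtain ⟨hp0, hdet⟩ := isSaddle_iff.1 hp
  rw [hs.hasFDerivAt_left.fderiv] at hdet
  -- The factors are swapped because the implicit function theorem solves for the second variable.
  set f : Param m × Plane → Plane := fun q => h q.2 q.1 with hf
  have hfs : ContDiffAt ℝ 1 f (μ₀, p) := hs.comp (μ₀, p) (contDiffAt_snd.prodMk contDiffAt_fst)
  have hfd : fderiv ℝ f (μ₀, p) ∘L .inr ℝ (Param m) Plane =
      fderiv ℝ (fun q : Plane × Param m => h q.1 q.2) (p, μ₀) ∘L
        ContinuousLinearMap.inl ℝ Plane (Param m) :=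
    ((hfs.hasFDerivAt_right (h := fun μ x => h x μ)).unique hs.hasFDerivAt_left)
  have hinv : (fderiv ℝ f (μ₀, p) ∘L .inr ℝ (Param m) Plane).IsInvertible := by
    rw [hfd]; exact Plane.isInvertible_of_determinant hdet.ne
  set P := hfs.implicitFunction one_ne_zero hinv
  have hP0 : P μ₀ = p := hfs.implicitFunction_apply_self one_ne_zero hinv
  have hPc : ContinuousAt P μ₀ :=
    (hfs.contDiffAt_implicitFunction one_ne_zero hinv).continuousAt
  have hPeq := hfs.eventually_apply_implicitFunction one_ne_zero hinv
  have hpair : Tendsto (fun μ => (P μ, μ)) (𝓝 μ₀) (𝓝 (p, μ₀)) := by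
    have := hPc.prodMk continuousAt_id
    rw [ContinuousAt, hP0] at this
    exact this
  have hdetc : Tendsto (fun q => Plane.determinant
      (fderiv ℝ (fun q : Plane × Param m => h q.1 q.2) q ∘L
        ContinuousLinearMap.inl ℝ Plane (Param m))) (𝓝 (p, μ₀)) (𝓝 (Plane.determinant
      (fderiv ℝ (fun q : Plane × Param m => h q.1 q.2) (p, μ₀) ∘L
        ContinuousLinearMap.inl ℝ Plane (Param m)))) :=
    (Plane.continuous_determinant.tendsto _).comp
      ((hs.continuousAt_fderiv one_ne_zero).clm_comp continuousAt_const)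
  refine ⟨P, hP0, hPc, ?_⟩
  filter_upwards [hPeq, hpair.eventually (hs.eventually (by simp)),
    (hdetc.comp hpair).eventually_lt_const hdet] with μ h1 h2 h3
  refine isSaddle_iff.2 ⟨h1.trans hp0, ?_⟩
  rw [h2.hasFDerivAt_left.fderiv]
  exact h3

end SaddleContinuation

/-! ### Transversal half-orbits from a saddle, with `σ` recording the side of the section. -/

/-- The trajectory `γ` of `h(·, μ₀)` on `(-∞, 0]` emanates from the saddle `p`, lies with `p` in the
compact set `K`, near which `h` is smooth, and in the half plane `{σ x₁ < σ c}` up to time `0`,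
when it crosses the line `{x₁ = c}` transversally. -/
structure IsTransversalOrbit {m : ℕ} (h : Plane → Param m → Plane) (μ₀ : Param m) (K : Set Plane)
    (p : Plane) (γ : ℝ → Plane) (c σ : ℝ) : Prop where
  isCompact : IsCompact K
  contDiffAt : ∀ k ∈ K, ContDiffAt ℝ 1 (fun q : Plane × Param m => h q.1 q.2) (k, μ₀)
  saddle_mem : p ∈ K
  orbit_mem : ∀ t ∈ Iic (0 : ℝ), γ t ∈ K
  isSaddle : IsSaddle (fun x => h x μ₀) p
  isIntegralCurveOn : IsIntegralCurveOn γ (fun _ x => h x μ₀) (Iic 0)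
  tendsto : Tendsto γ atBot (𝓝 p)
  saddle_side : σ * p 0 < σ * c
  orbit_side : ∀ t < 0, σ * γ t 0 < σ * c
  orbit_zero : γ 0 0 = c
  transversal : 0 < σ * h (γ 0) μ₀ 0

/-- The derivative of `h` with respect to state and parameter at the parameter `μ₀`. -/
noncomputable def jointDeriv {m : ℕ} (h : Plane → Param m → Plane) (μ₀ : Param m) (x : Plane) :
    Plane × Param m →L[ℝ] Plane :=
  fderiv ℝ (fun q : Plane × Param m => h q.1 q.2) (x, μ₀)

noncomputable def stateDeriv {m : ℕ} (h : Plane → Param m → Plane) (μ₀ : Param m) (x : Plane) :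
    Plane →L[ℝ] Plane :=
  jointDeriv h μ₀ x ∘L ContinuousLinearMap.inl ℝ Plane (Param m)

noncomputable def paramDeriv {m : ℕ} (h : Plane → Param m → Plane) (μ₀ : Param m) (x : Plane) :
    Param m →L[ℝ] Plane :=
  jointDeriv h μ₀ x ∘L ContinuousLinearMap.inr ℝ Plane (Param m)

namespace IsTransversalOrbit

variable {m : ℕ} {h : Plane → Param m → Plane} {μ₀ : Param m} {K : Set Plane} {p : Plane}
  {γ : ℝ → Plane} {c σ : ℝ}

theorem continuousOn_jointDeriv (H : IsTransversalOrbit h μ₀ K p γ c σ) :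
    ContinuousOn (jointDeriv h μ₀) K := fun k hk =>
  (ContinuousAt.comp (f := fun x : Plane => (x, μ₀)) (x := k)
    ((H.contDiffAt k hk).continuousAt_fderiv one_ne_zero)
    (continuousAt_id.prodMk continuousAt_const)).continuousWithinAt

theorem exists_uniform (H : IsTransversalOrbit h μ₀ K p γ c σ) {η : ℝ} (hη : 0 < η) :
    ∃ r > 0, ∀ k ∈ K, ∀ q₁ ∈ Metric.ball (k, μ₀) r, ∀ q₂ ∈ Metric.ball (k, μ₀) r,
      ‖h q₁.1 q₁.2 - h q₂.1 q₂.2 - jointDeriv h μ₀ k (q₁ - q₂)‖ ≤ η * ‖q₁ - q₂‖ :=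
  H.isCompact.exists_uniform_strict H.continuousOn_jointDeriv
    (fun k hk => (H.contDiffAt k hk).hasStrictFDerivAt one_ne_zero) hη

theorem continuousOn_orbit (H : IsTransversalOrbit h μ₀ K p γ c σ) : ContinuousOn γ (Iic 0) :=
  fun t ht => (H.isIntegralCurveOn t ht).continuousWithinAt

theorem continuousOn_jointDeriv_orbit (H : IsTransversalOrbit h μ₀ K p γ c σ) :
    ContinuousOn (fun t => jointDeriv h μ₀ (γ t)) (Iic 0) :=
  H.continuousOn_jointDeriv.comp H.continuousOn_orbit H.orbit_mem

theorem continuousOn_stateDeriv_orbit (H : IsTransversalOrbit h μ₀ K p γ c σ) :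
    ContinuousOn (fun t => stateDeriv h μ₀ (γ t)) (Iic 0) :=
  H.continuousOn_jointDeriv_orbit.clm_comp continuousOn_const

theorem continuousOn_paramDeriv_orbit (H : IsTransversalOrbit h μ₀ K p γ c σ) :
    ContinuousOn (fun t => paramDeriv h μ₀ (γ t)) (Iic 0) :=
  H.continuousOn_jointDeriv_orbit.clm_comp continuousOn_const

theorem tendsto_jointDeriv_orbit (H : IsTransversalOrbit h μ₀ K p γ c σ) :
    Tendsto (fun t => jointDeriv h μ₀ (γ t)) atBot (𝓝 (jointDeriv h μ₀ p)) := by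
  refine (H.continuousOn_jointDeriv p H.saddle_mem).tendsto.comp
    (tendsto_nhdsWithin_iff.2 ⟨H.tendsto, ?_⟩)
  filter_upwards [eventually_le_atBot (0 : ℝ)] with t ht using H.orbit_mem t ht

theorem tendsto_stateDeriv_orbit (H : IsTransversalOrbit h μ₀ K p γ c σ) :
    Tendsto (fun t => stateDeriv h μ₀ (γ t)) atBot (𝓝 (stateDeriv h μ₀ p)) :=
  ((by fun_prop : Continuous fun L : Plane × Param m →L[ℝ] Plane =>
    L ∘L ContinuousLinearMap.inl ℝ Plane (Param m)).tendsto _).comp H.tendsto_jointDeriv_orbit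

theorem hasFDerivAt_state (H : IsTransversalOrbit h μ₀ K p γ c σ) {k : Plane} (hk : k ∈ K) :
    HasFDerivAt (fun x => h x μ₀) (stateDeriv h μ₀ k) k :=
  (H.contDiffAt k hk).hasFDerivAt_left

theorem hasFDerivAt_param (H : IsTransversalOrbit h μ₀ K p γ c σ) {k : Plane} (hk : k ∈ K) :
    HasFDerivAt (fun μ => h k μ) (paramDeriv h μ₀ k) μ₀ :=
  (H.contDiffAt k hk).hasFDerivAt_right

theorem determinant_neg (H : IsTransversalOrbit h μ₀ K p γ c σ) :
    Plane.determinant (stateDeriv h μ₀ p) < 0 := by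
  rw [← (H.hasFDerivAt_state H.saddle_mem).fderiv]
  exact (isSaddle_iff.1 H.isSaddle).2

/-- The velocity solves the variational equation. It is the bounded solution `φ` around which the
moving frame is built. -/
theorem hasDerivWithinAt_velocity (H : IsTransversalOrbit h μ₀ K p γ c σ) :
    ∀ t ∈ Iic (0 : ℝ), HasDerivWithinAt (fun t => h (γ t) μ₀)
      (stateDeriv h μ₀ (γ t) (h (γ t) μ₀)) (Iic 0) t := fun t ht =>
  (H.hasFDerivAt_state (H.orbit_mem t ht)).comp_hasDerivWithinAt t (H.isIntegralCurveOn t ht)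

theorem exists_bound_velocity (H : IsTransversalOrbit h μ₀ K p γ c σ) :
    ∃ C > 0, ∀ t ∈ Iic (0 : ℝ), ‖h (γ t) μ₀‖ ≤ C :=
  exists_bound_Iic (fun t ht => (H.hasDerivWithinAt_velocity t ht).continuousWithinAt)
    ((H.hasFDerivAt_state H.saddle_mem).continuousAt.tendsto.comp H.tendsto)

theorem velocity_zero_ne (H : IsTransversalOrbit h μ₀ K p γ c σ) : h (γ 0) μ₀ 0 ≠ 0 := by
  intro h0
  have := H.transversal
  rw [h0, mul_zero] at this
  exact this.false

/-- Trajectories of nearby vector fields which stay close to the reference orbit tend to the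
continued saddle. -/
theorem exists_tendsto (H : IsTransversalOrbit h μ₀ K p γ c σ) {P : Param m → Plane}
    (hP : IsSaddleContinuation h μ₀ p P) :
    ∃ r > 0, ∀ᶠ μ in 𝓝 μ₀, ∀ x : ℝ → Plane, IsIntegralCurveOn x (fun _ y => h y μ) (Iic 0) →
      (∀ t ≤ 0, dist (x t) (γ t) < r) → Tendsto x atBot (𝓝 (P μ)) := by
  obtain ⟨a, b, πs, πu, ha, hb, -, hsum, hs, hu, -⟩ := Plane.exists_splitting H.determinant_neg
  obtain ⟨κ, hκ, hdecay⟩ := exists_tendsto_zero ha hb hsum hs hu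
  obtain ⟨r, hr, hU⟩ := H.exists_uniform hκ
  have hU := hU p H.saddle_mem
  obtain ⟨hP0, hPc, hPs⟩ := hP
  have hPr : ∀ᶠ μ in 𝓝 μ₀, dist (P μ) p < r := by
    rw [ContinuousAt, hP0] at hPc
    exact hPc.eventually (Metric.ball_mem_nhds p hr)
  have hμr : ∀ᶠ μ in 𝓝 μ₀, dist μ μ₀ < r := Metric.ball_mem_nhds μ₀ hr
  obtain ⟨T, hT⟩ := eventually_atBot.1 (H.tendsto.eventually (Metric.ball_mem_nhds p (half_pos hr)))
  refine ⟨r / 2, half_pos hr, ?_⟩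
  filter_upwards [hPr, hμr, hPs] with μ h1 h2 h3 x hx hxγ
  set T' := min T 0
  have hT'0 : T' ≤ 0 := min_le_right _ _
  have hsub : Iic T' ⊆ Iic (0 : ℝ) := Iic_subset_Iic.2 hT'0
  have hxp : ∀ t ∈ Iic T', dist (x t) p < r := by
    intro t ht
    calc dist (x t) p ≤ dist (x t) (γ t) + dist (γ t) p := dist_triangle _ _ _
      _ < r / 2 + r / 2 := add_lt_add (hxγ t (hsub ht)) (hT t (le_trans ht (min_le_left _ _)))
      _ = r := by ring
  have hball : ∀ y : Plane, dist y p < r → (y, μ) ∈ Metric.ball (p, μ₀) r := by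
    intro y hy
    rw [Metric.mem_ball, Prod.dist_eq]
    exact max_lt hy h2
  -- Since `h (P μ) μ = 0`, strict differentiability at `(p, μ₀)` shows that the deviation from `P
  -- μ` solves the linearisation at `p` up to an error `κ ‖x - P μ‖`, so the dichotomy applies.
  have hlim := hdecay T' (fun t => x t - P μ) (fun t => h (x t) μ)
    (fun t ht => ((hx t (hsub ht)).mono hsub).sub_const _) (fun t ht => by
      have := hU _ (hball _ (hxp t ht)) _ (hball _ h1)
      simp only [h3.1, sub_zero, Prod.mk_sub_mk, sub_self] at this
      refine this.trans_eq ?_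
      rw [Prod.norm_mk, norm_zero, max_eq_left (norm_nonneg _)])
    ⟨2 * r, fun t ht => by
      rw [← dist_eq_norm]
      have := dist_triangle_right (x t) (P μ) p
      linarith [hxp t ht]⟩
  simpa using hlim.add_const (P μ)

/-- Trajectories of nearby vector fields which stay close to the reference orbit and meet the
section at time `0` do so for the first time. -/
theorem exists_side (H : IsTransversalOrbit h μ₀ K p γ c σ) :
    ∃ r > 0, ∀ᶠ μ in 𝓝 μ₀, ∀ x : ℝ → Plane, IsIntegralCurveOn x (fun _ y => h y μ) (Iic 0) →
      (∀ t ≤ 0, dist (x t) (γ t) < r) → x 0 0 = c → ∀ t < 0, σ * x t 0 < σ * c := by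
  have hcont : ContinuousAt (fun q : Plane × Param m => σ * h q.1 q.2 0) (γ 0, μ₀) := by
    have h1 := (H.contDiffAt _ (H.orbit_mem 0 self_mem_Iic)).continuousAt
    exact continuousAt_const.mul
      ((EuclideanSpace.proj (0 : Fin 2) : Plane →L[ℝ] ℝ).continuous.continuousAt.comp h1)
  obtain ⟨r, hr, hpos⟩ := Metric.eventually_nhds_iff_ball.1
    (hcont.eventually (lt_mem_nhds H.transversal))
  have h0 := (H.continuousOn_orbit 0 self_mem_Iic).eventually
    (Metric.ball_mem_nhds (γ 0) (half_pos hr))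
  obtain ⟨τ, hτ, hτr⟩ := Metric.eventually_nhds_iff_ball.1 (eventually_nhdsWithin_iff.1 h0)
  have hfc : ContinuousOn (fun t => σ * γ t 0) (Iic 0) := fun t ht =>
    continuousWithinAt_const.mul
      ((EuclideanSpace.proj (0 : Fin 2) : Plane →L[ℝ] ℝ).continuous.continuousAt.comp_continuousWithinAt
        (H.continuousOn_orbit t ht))
  -- Away from time `0` the orbit keeps a uniform distance from the line: near `-∞` because the
  -- saddle is off the line, and on the remaining interval by compactness.
  have hgap : ∃ κ > 0, ∀ t ≤ -(τ / 2), σ * γ t 0 ≤ σ * c - κ := by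
    have hlim : Tendsto (fun t => σ * γ t 0) atBot (𝓝 (σ * p 0)) :=
      (((EuclideanSpace.proj (0 : Fin 2) : Plane →L[ℝ] ℝ).continuous.tendsto p).comp
        H.tendsto).const_mul σ
    have hmid : σ * p 0 < (σ * p 0 + σ * c) / 2 := by linarith [H.saddle_side]
    obtain ⟨T, hT⟩ := eventually_atBot.1 (hlim.eventually_lt_const hmid)
    have hsub : Icc (min T (-(τ / 2))) (-(τ / 2)) ⊆ Iic (0 : ℝ) := fun t ht => by
      have := ht.2; simp only [mem_Iic]; linarith
    obtain ⟨t₀, ht₀, hmax⟩ := isCompact_Icc.exists_isMaxOn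
      (nonempty_Icc.2 (min_le_right T (-(τ / 2)))) (hfc.mono hsub)
    have ht₀' : σ * γ t₀ 0 < σ * c := H.orbit_side t₀ (by have := ht₀.2; linarith)
    refine ⟨min ((σ * c - σ * p 0) / 2) (σ * c - σ * γ t₀ 0),
      lt_min (by linarith [H.saddle_side]) (by linarith), fun t ht => ?_⟩
    rcases le_total t (min T (-(τ / 2))) with h1 | h1
    · have h2 := hT t (h1.trans (min_le_left _ _))
      have h3 := min_le_left ((σ * c - σ * p 0) / 2) (σ * c - σ * γ t₀ 0)
      linarith
    · have h2 : σ * γ t 0 ≤ σ * γ t₀ 0 := hmax ⟨h1, ht⟩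
      have h3 := min_le_right ((σ * c - σ * p 0) / 2) (σ * c - σ * γ t₀ 0)
      linarith
  obtain ⟨κ, hκ, hgap⟩ := hgap
  refine ⟨min (r / 2) (κ / (|σ| + 1)), lt_min (half_pos hr) (by positivity), ?_⟩
  have hμr : ∀ᶠ μ in 𝓝 μ₀, dist μ μ₀ < r := Metric.ball_mem_nhds μ₀ hr
  filter_upwards [hμr] with μ hμ x hx hxγ hx0 t ht
  rcases le_total t (-(τ / 2)) with h1 | h1
  · have h2 := hgap t h1
    have h3 : |x t 0 - γ t 0| < κ / (|σ| + 1) := by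
      have h4 : ‖(x t - γ t) 0‖ ≤ ‖x t - γ t‖ := PiLp.norm_apply_le _ _
      rw [← dist_eq_norm] at h4
      exact (h4.trans_lt (hxγ t ht.le)).trans_le (min_le_right _ _)
    have h5 : σ * (x t 0 - γ t 0) < κ := by
      calc σ * (x t 0 - γ t 0) ≤ |σ| * |x t 0 - γ t 0| := by
            rw [← abs_mul]; exact le_abs_self _
        _ ≤ (|σ| + 1) * |x t 0 - γ t 0| := by gcongr; linarith
        _ < (|σ| + 1) * (κ / (|σ| + 1)) := by gcongr
        _ = κ := by field_simp
    linarith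
  · have hder : ∀ s ∈ Iic (0 : ℝ), HasDerivWithinAt (fun s => σ * x s 0) (σ * h (x s) μ 0)
        (Iic 0) s := fun s hs =>
      ((EuclideanSpace.proj (0 : Fin 2) : Plane →L[ℝ] ℝ).hasFDerivAt.comp_hasDerivWithinAt s
        (hx s hs)).const_mul σ
    -- Close to time `0` the trajectory stays where the horizontal speed is positive, so it cannot
    -- reach the line before `0`.
    have hmono : StrictMonoOn (fun s => σ * x s 0) (Icc (-(τ / 2)) 0) := by
      refine strictMonoOn_of_deriv_pos (convex_Icc _ _)
        (fun s hs => (hder s hs.2).continuousWithinAt.mono Icc_subset_Iic_self) ?_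
      intro s hs
      rw [interior_Icc] at hs
      rw [((hder s hs.2.le).Iic_hasDerivAt hs.2).deriv]
      refine hpos (x s, μ) ?_
      rw [Metric.mem_ball, Prod.dist_eq]
      refine max_lt ?_ hμ
      have h2 : dist (γ s) (γ 0) < r / 2 := hτr s (by
        rw [Metric.mem_ball, Real.dist_eq, sub_zero, abs_lt]
        exact ⟨by linarith [hs.1], by linarith [hs.2]⟩) hs.2.le
      calc dist (x s) (γ 0) ≤ dist (x s) (γ s) + dist (γ s) (γ 0) := dist_triangle _ _ _
        _ < r / 2 + r / 2 := add_lt_add ((hxγ s hs.2.le).trans_le (min_le_left _ _)) h2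
        _ = r := by ring
    have := hmono ⟨h1, ht.le⟩ ⟨by linarith, le_rfl⟩ ht
    simpa only [hx0] using this

end IsTransversalOrbit

/-! ### The nonlinear boundary value problem for nearby trajectories. -/

theorem mem_ball_prod {E F : Type*} [NormedAddCommGroup E] [NormedAddCommGroup F] {k y : E}
    {μ μ₀ : F} {r : ℝ} (hy : ‖y - k‖ < r) (hμ : ‖μ - μ₀‖ < r) :
    (y, μ) ∈ Metric.ball (k, μ₀) r := by
  rw [Metric.mem_ball, Prod.dist_eq, dist_eq_norm, dist_eq_norm]
  exact max_lt hy hμ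

namespace IsTransversalOrbit

variable {m : ℕ} {h : Plane → Param m → Plane} {μ₀ : Param m} {K : Set Plane} {p : Plane}
  {γ : ℝ → Plane} {c σ : ℝ}

/-- The nonlinear remainder of the equation for the deviation `y` from the orbit `γ`. -/
noncomputable def _root_.deviationForcing {m : ℕ} (h : Plane → Param m → Plane) (μ₀ : Param m)
    (γ : ℝ → Plane) (μ : Param m) (y : ℝ → Plane) (t : ℝ) : Plane :=
  h (γ t + y t) μ - h (γ t) μ₀ - stateDeriv h μ₀ (γ t) (y t)

theorem hasDerivWithinAt_add_orbit (H : IsTransversalOrbit h μ₀ K p γ c σ) {μ : Param m}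
    {y : ℝ → Plane}
    (hy : ∀ t ∈ Iic (0 : ℝ), HasDerivWithinAt y
      (stateDeriv h μ₀ (γ t) (y t) + deviationForcing h μ₀ γ μ y t) (Iic 0) t) :
    IsIntegralCurveOn (fun t => γ t + y t) (fun _ x => h x μ) (Iic 0) := fun t ht =>
  ((H.isIntegralCurveOn t ht).add (hy t ht)).congr_deriv (by
    simp only [deviationForcing]; abel)

theorem hasDerivWithinAt_deviation (H : IsTransversalOrbit h μ₀ K p γ c σ) {μ : Param m}
    {x : ℝ → Plane} (hx : IsIntegralCurveOn x (fun _ x => h x μ) (Iic 0)) :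
    ∀ t ∈ Iic (0 : ℝ), HasDerivWithinAt (fun t => x t - γ t)
      (stateDeriv h μ₀ (γ t) (x t - γ t) + deviationForcing h μ₀ γ μ (fun t => x t - γ t) t)
      (Iic 0) t := fun t ht =>
  ((hx t ht).sub (H.isIntegralCurveOn t ht)).congr_deriv (by
    simp only [deviationForcing, add_sub_cancel])

/-- The `μ`-components cancel in the difference of the two points, so only the state derivative
acts. This is the form to which the uniform strict bound applies. -/
theorem deviationForcing_sub_eq (μ : Param m) (y z : ℝ → Plane) (t : ℝ) :
    deviationForcing h μ₀ γ μ y t - deviationForcing h μ₀ γ μ z t =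
      h (γ t + y t) μ - h (γ t + z t) μ -
        jointDeriv h μ₀ (γ t) ((γ t + y t, μ) - (γ t + z t, μ)) := by
  have : ((γ t + y t, μ) - (γ t + z t, μ) : Plane × Param m) = (y t - z t, 0) := by
    ext <;> simp
  rw [this]
  have h2 : jointDeriv h μ₀ (γ t) (y t - z t, 0) = stateDeriv h μ₀ (γ t) (y t - z t) := rfl
  rw [h2, map_sub]
  simp only [deviationForcing]
  abel

/-- Near the orbit the remainder has arbitrarily small Lipschitz constant in the deviation, by
uniform strict differentiability. At zero deviation only the change of parameter contributes, whence
the term `M ‖μ - μ₀‖`. -/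
theorem exists_forcing_estimate (H : IsTransversalOrbit h μ₀ K p γ c σ) {η : ℝ} (hη : 0 < η) :
    ∃ r > 0, ∃ M > 0, ∀ μ : Param m, ‖μ - μ₀‖ < r →
      (∀ y z : ℝ → Plane, ∀ t ∈ Iic (0 : ℝ), ‖y t‖ < r → ‖z t‖ < r →
        ‖deviationForcing h μ₀ γ μ y t - deviationForcing h μ₀ γ μ z t‖ ≤ η * ‖y t - z t‖) ∧
      (∀ y : ℝ → Plane, ∀ t ∈ Iic (0 : ℝ), ‖y t‖ < r →
        ‖deviationForcing h μ₀ γ μ y t‖ ≤ η * ‖y t‖ + M * ‖μ - μ₀‖) ∧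
      ∀ y : ℝ → Plane, ContinuousOn y (Iic 0) → (∀ t ∈ Iic (0 : ℝ), ‖y t‖ < r) →
        ContinuousOn (deviationForcing h μ₀ γ μ y) (Iic 0) := by
  obtain ⟨r, hr, hU⟩ := H.exists_uniform hη
  obtain ⟨M, hM0, hM⟩ := exists_bound_Iic H.continuousOn_jointDeriv_orbit
    H.tendsto_jointDeriv_orbit
  have hball : ∀ μ : Param m, ‖μ - μ₀‖ < r → ∀ t : ℝ, ∀ y : Plane, ‖y‖ < r →
      (γ t + y, μ) ∈ Metric.ball (γ t, μ₀) r := fun μ hμ t y hy =>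
    mem_ball_prod (by rwa [add_sub_cancel_left]) hμ
  have hdiff : ∀ μ : Param m, ‖μ - μ₀‖ < r → ∀ y z : ℝ → Plane, ∀ t ∈ Iic (0 : ℝ), ‖y t‖ < r →
      ‖z t‖ < r →
      ‖deviationForcing h μ₀ γ μ y t - deviationForcing h μ₀ γ μ z t‖ ≤ η * ‖y t - z t‖ := by
    intro μ hμ y z t ht hy hz
    have := hU _ (H.orbit_mem t ht) _ (hball μ hμ t _ hy) _ (hball μ hμ t _ hz)
    rw [deviationForcing_sub_eq]
    refine this.trans_eq ?_
    rw [Prod.mk_sub_mk, sub_self, add_sub_add_left_eq_sub, Prod.norm_mk, norm_zero,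
      max_eq_left (norm_nonneg _)]
  refine ⟨r, hr, η + M, by positivity, fun μ hμ => ⟨hdiff μ hμ, fun y t ht hy => ?_,
    fun y hyc hy t ht => ?_⟩⟩
  · have h0 : ‖(0 : Plane)‖ < r := by rwa [norm_zero]
    have h1 := hdiff μ hμ y (fun _ => 0) t ht hy h0
    have h2 := hU _ (H.orbit_mem t ht) _ (hball μ hμ t 0 h0) _
      (Metric.mem_ball_self hr)
    have h3 : ((γ t + 0, μ) - (γ t, μ₀) : Plane × Param m) = (0, μ - μ₀) := by
      ext <;> simp
    have h4 : ‖((0 : Plane), μ - μ₀)‖ = ‖μ - μ₀‖ := by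
      rw [Prod.norm_mk, norm_zero, max_eq_right (norm_nonneg _)]
    rw [h3, h4] at h2
    have h5 : ‖jointDeriv h μ₀ (γ t) (0, μ - μ₀)‖ ≤ M * ‖μ - μ₀‖ := by
      rw [← h4]; exact (jointDeriv h μ₀ (γ t)).le_of_opNorm_le (hM t ht) _
    have h6 : ‖deviationForcing h μ₀ γ μ (fun _ => 0) t‖ ≤ (η + M) * ‖μ - μ₀‖ := by
      calc ‖deviationForcing h μ₀ γ μ (fun _ => 0) t‖
          = ‖(h (γ t + 0) μ - h (γ t) μ₀ - jointDeriv h μ₀ (γ t) (0, μ - μ₀)) +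
              jointDeriv h μ₀ (γ t) (0, μ - μ₀)‖ := by
            simp only [deviationForcing, map_zero]; congr 1; abel
        _ ≤ η * ‖μ - μ₀‖ + M * ‖μ - μ₀‖ := (norm_add_le _ _).trans (add_le_add h2 h5)
        _ = _ := by ring
    rw [sub_zero] at h1
    calc ‖deviationForcing h μ₀ γ μ y t‖
        = ‖(deviationForcing h μ₀ γ μ y t - deviationForcing h μ₀ γ μ (fun _ => 0) t) +
            deviationForcing h μ₀ γ μ (fun _ => 0) t‖ := by congr 1; abel
      _ ≤ _ := (norm_add_le _ _).trans (add_le_add h1 h6)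
  · have h1 : ContinuousWithinAt (fun t => h (γ t + y t) μ) (Iic 0) t :=
      ContinuousAt.comp_continuousWithinAt (g := fun q : Plane × Param m => h q.1 q.2)
        (f := fun t => (γ t + y t, μ))
        (continuousAt_of_strict_bound (H := fun q : Plane × Param m => h q.1 q.2)
          (hU _ (H.orbit_mem t ht)) (hball μ hμ t _ (hy t ht)))
        (((H.continuousOn_orbit t ht).add (hyc t ht)).prodMk continuousWithinAt_const)
    exact (h1.sub (H.hasDerivWithinAt_velocity t ht).continuousWithinAt).sub
      ((H.continuousOn_stateDeriv_orbit t ht).clm_apply (hyc t ht))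

open BoundedContinuousFunction in
/-- For parameters near `μ₀` there is exactly one trajectory which stays close to the reference
orbit and ends on the section, and its distance from the orbit is controlled by the parameter. -/
theorem exists_unique_nearby (H : IsTransversalOrbit h μ₀ K p γ c σ) :
    ∃ r > 0, ∃ C > 0, ∀ᶠ μ in 𝓝 μ₀, ∃ x : ℝ → Plane,
      IsIntegralCurveOn x (fun _ y => h y μ) (Iic 0) ∧
      (∀ t ≤ 0, ‖x t - γ t‖ ≤ C * ‖μ - μ₀‖) ∧ x 0 0 = c ∧
      ∀ x' : ℝ → Plane, IsIntegralCurveOn x' (fun _ y => h y μ) (Iic 0) →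
        (∀ t ≤ 0, dist (x' t) (γ t) < r) → x' 0 0 = c → x' 0 = x 0 := by
  obtain ⟨Cφ, -, hCφ⟩ := H.exists_bound_velocity
  obtain ⟨L, hL, hbound, hexist⟩ := exists_estimate_linear H.continuousOn_stateDeriv_orbit
    H.tendsto_stateDeriv_orbit H.determinant_neg H.hasDerivWithinAt_velocity hCφ H.velocity_zero_ne
  -- With this Lipschitz constant the linear solution operator, of norm at most `L`, turns the
  -- forcing into a map that contracts by `1/2`.
  set η := 1 / (2 * L) with hη
  have hη0 : 0 < η := by positivity
  have hLη : ∀ s : ℝ, L * (η * s) = s / 2 := fun s => by rw [hη]; field_simp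
  obtain ⟨r, hr, M, hM, hforce⟩ := H.exists_forcing_estimate hη0
  refine ⟨r, hr, 2 * L * M, by positivity, ?_⟩
  have hμr := eventually_norm_sub_lt μ₀ hr
  have hμs := eventually_norm_sub_lt μ₀ (show 0 < r / (4 * L * M) by positivity)
  filter_upwards [hμr, hμs] with μ hμ hμ'
  obtain ⟨hf1, hf2, hf3⟩ := hforce μ hμ
  -- For `‖y‖ ≤ r/2` the image has norm at most `r/4 + r/4`, so the closed ball of radius `r/2` is
  -- preserved.
  have hsmall : L * (M * ‖μ - μ₀‖) ≤ r / 4 := by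
    rw [lt_div_iff₀ (by positivity)] at hμ'
    linarith
  set N := deviationForcing h μ₀ γ μ
  set A : ℝ → Plane →L[ℝ] Plane := fun t => stateDeriv h μ₀ (γ t)
  -- Deviations are frozen at their value at `0` for positive times, so that they live in the
  -- complete space of bounded continuous functions on `ℝ` with a norm determined by `(-∞, 0]`.
  have hstep : ∀ y : ℝ →ᵇ Plane, ‖y‖ ≤ r / 2 → ∃ z : ℝ →ᵇ Plane, z 0 0 = 0 ∧
      (∀ t, z t = z (min t 0)) ∧
      ∀ t ∈ Iic (0 : ℝ), HasDerivWithinAt z (A t (z t) + N y t) (Iic 0) t := by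
    intro y hy
    have hyr : ∀ t, ‖y t‖ < r := fun t => (y.norm_coe_le_norm t).trans_lt (by linarith)
    obtain ⟨w, C, hw0, hwC, hw⟩ := hexist (N y) (η * r + M * ‖μ - μ₀‖)
      (hf3 y y.continuous.continuousOn fun t _ => hyr t) (fun t ht => by
        refine (hf2 y t ht (hyr t)).trans ?_
        gcongr
        exact (hyr t).le)
    have hwc : ContinuousOn w (Iic 0) := fun t ht => (hw t ht).continuousWithinAt
    refine ⟨BoundedContinuousFunction.ofNormedAddCommGroup (fun t => w (min t 0))
      (hwc.comp_continuous (by fun_prop) fun t => min_le_right t 0) C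
      (fun t => hwC _ (min_le_right t 0)), ?_, fun t => ?_, fun t ht => ?_⟩
    · simpa using hw0
    · simp
    · have heq : ∀ s ∈ Iic (0 : ℝ), w (min s 0) = w s := fun s hs => by
        rw [min_eq_left hs]
      simp only [BoundedContinuousFunction.coe_ofNormedAddCommGroup]
      rw [heq t ht]
      exact (hw t ht).congr heq (heq t ht)
  choose! Φ hΦ0 hΦmin hΦ using hstep
  have hnorm : ∀ (z : ℝ →ᵇ Plane) (B : ℝ), 0 ≤ B → (∀ t, z t = z (min t 0)) →
      (∀ t ∈ Iic (0 : ℝ), ‖z t‖ ≤ B) → ‖z‖ ≤ B := by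
    intro z B hB hz hb
    refine (BoundedContinuousFunction.norm_le hB).2 fun t => ?_
    rw [hz t]
    exact hb _ (min_le_right t 0)
  have hΦnorm : ∀ y : ℝ →ᵇ Plane, ‖y‖ ≤ r / 2 → ‖Φ y‖ ≤ ‖y‖ / 2 + L * (M * ‖μ - μ₀‖) := by
    intro y hy
    refine hnorm _ _ (by positivity) (hΦmin y hy) fun t ht => ?_
    refine (hbound (N y) (Φ y) (η * ‖y‖ + M * ‖μ - μ₀‖) ‖Φ y‖ (fun s hs => ?_) (hΦ y hy)
      (fun s _ => (Φ y).norm_coe_le_norm s) (hΦ0 y hy) t ht).trans_eq ?_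
    · have h1 := y.norm_coe_le_norm s
      refine (hf2 y s hs (h1.trans_lt (by linarith))).trans ?_
      gcongr
    · rw [mul_add, hLη]
  have hΦlip : ∀ y z : ℝ →ᵇ Plane, ‖y‖ ≤ r / 2 → ‖z‖ ≤ r / 2 →
      ‖Φ y - Φ z‖ ≤ ‖y - z‖ / 2 := by
    intro y z hy hz
    refine hnorm _ _ (by positivity) (fun t => ?_) fun t ht => ?_
    · simp only [BoundedContinuousFunction.coe_sub, Pi.sub_apply]
      rw [hΦmin y hy t, hΦmin z hz t]
    · refine (hbound (fun s => N y s - N z s) (Φ y - Φ z : ℝ →ᵇ Plane) (η * ‖y - z‖) ‖Φ y - Φ z‖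
        (fun s hs => ?_) (fun s hs => ?_)
        (fun s _ => (Φ y - Φ z).norm_coe_le_norm s) ?_ t ht).trans_eq (hLη _)
      · have h1 := y.norm_coe_le_norm s
        have h2 := z.norm_coe_le_norm s
        refine (hf1 y z s hs (h1.trans_lt (by linarith)) (h2.trans_lt (by linarith))).trans ?_
        gcongr
        exact (y - z).norm_coe_le_norm s
      · refine ((hΦ y hy s hs).sub (hΦ z hz s hs)).congr_deriv ?_
        simp only [BoundedContinuousFunction.coe_sub, Pi.sub_apply, map_sub]
        abel
      · simp [hΦ0 y hy, hΦ0 z hz]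
  set S : Set (ℝ →ᵇ Plane) := Metric.closedBall 0 (r / 2) with hS
  have hmemS : ∀ y : ℝ →ᵇ Plane, y ∈ S ↔ ‖y‖ ≤ r / 2 := fun y => mem_closedBall_zero_iff
  have hmaps : MapsTo Φ S S := by
    intro y hy
    rw [hmemS] at hy ⊢
    have := hΦnorm y hy
    linarith
  have hcontr : ContractingWith (1 / 2) (hmaps.restrict Φ S S) := by
    refine ⟨by rw [div_lt_one] <;> norm_num, LipschitzWith.of_dist_le_mul fun y z => ?_⟩
    rw [Subtype.dist_eq, Subtype.dist_eq, dist_eq_norm, dist_eq_norm]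
    have := hΦlip y z ((hmemS _).1 y.2) ((hmemS _).1 z.2)
    simp only [MapsTo.val_restrict_apply, NNReal.coe_div, NNReal.coe_one, NNReal.coe_ofNat]
    linarith
  obtain ⟨y, hyS, hyfix, -⟩ := hcontr.exists_fixedPoint' Metric.isClosed_closedBall.isComplete
    hmaps (x := 0) (by rw [hmemS, norm_zero]; positivity) (edist_ne_top _ _)
  rw [hmemS] at hyS
  have hyfix : Φ y = y := hyfix
  have hyd := hΦ y hyS
  have hy0 := hΦ0 y hyS
  have hyn := hΦnorm y hyS
  rw [hyfix] at hyd hy0 hyn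
  have hyr : ∀ t, ‖y t‖ < r := fun t => (y.norm_coe_le_norm t).trans_lt (by linarith)
  refine ⟨fun t => γ t + y t, H.hasDerivWithinAt_add_orbit hyd, fun t _ => ?_, ?_, ?_⟩
  -- The fixed point satisfies `‖y‖ ≤ ‖y‖/2 + L M ‖μ - μ₀‖`, hence the constant `2 L M`.
  · rw [add_sub_cancel_left]
    have := y.norm_coe_le_norm t
    linarith
  · simp [hy0, H.orbit_zero]
  · intro x' hx' hx'γ hx'0
    have hzd := H.hasDerivWithinAt_deviation hx'
    set z : ℝ → Plane := fun t => x' t - γ t with hz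
    have hzr : ∀ t ∈ Iic (0 : ℝ), ‖z t‖ < r := fun t ht => by
      rw [hz, ← dist_eq_norm]; exact hx'γ t ht
    -- The competitor is only known to be within `r`, outside the ball of the fixed-point argument.
    -- Uniqueness comes instead from repeatedly halving a bound on the difference by means of the
    -- linear estimate.
    have hind : ∀ n : ℕ, ∀ t ∈ Iic (0 : ℝ), ‖z t - y t‖ ≤ 2 * r * (1 / 2) ^ n := by
      intro n
      induction n with
      | zero =>
        intro t ht
        have := norm_sub_le (z t) (y t)
        linarith [hzr t ht, hyr t]
      | succ n ih =>
        intro t ht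
        refine (hbound (fun s => N z s - N y s) (fun s => z s - y s)
          (η * (2 * r * (1 / 2) ^ n)) (2 * r * (1 / 2) ^ n) (fun s hs => ?_) (fun s hs => ?_) ih ?_
          t ht).trans_eq ?_
        · refine (hf1 z y s hs (hzr s hs) (hyr s)).trans ?_
          gcongr
          exact ih s hs
        · refine ((hzd s hs).sub (hyd s hs)).congr_deriv ?_
          simp only [map_sub, N, A, hz]
          abel
        · simp [hz, hx'0, hy0, H.orbit_zero]
        · rw [hLη]; ring
    have hlim : Tendsto (fun n : ℕ => 2 * r * (1 / 2 : ℝ) ^ n) atTop (𝓝 0) := by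
      simpa using (tendsto_pow_atTop_nhds_zero_of_lt_one (r := (1 / 2 : ℝ)) (by norm_num)
        (by norm_num)).const_mul (2 * r)
    have h0 : ‖z 0 - y 0‖ ≤ 0 := ge_of_tendsto' hlim fun n => hind n 0 self_mem_Iic
    have h1 : z 0 = y 0 := sub_eq_zero.1 (norm_le_zero_iff.1 h0)
    simp only [← h1, hz, add_sub_cancel]

end IsTransversalOrbit

/-! ### The adjoint solution and the derivative of the endpoint. -/

/-- Solutions of the adjoint equation that are orthogonal to the tangent direction decay
exponentially. -/
theorem exists_adjoint_decay {A : ℝ → Plane →L[ℝ] Plane} {A₀ : Plane →L[ℝ] Plane}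
    (hAc : ContinuousOn A (Iic 0)) (hA : Tendsto A atBot (𝓝 A₀))
    (hdet : Plane.determinant A₀ < 0) {φ ψ : ℝ → Plane} {C : ℝ}
    (hφ : ∀ t ∈ Iic (0 : ℝ), HasDerivWithinAt φ (A t (φ t)) (Iic 0) t)
    (hφC : ∀ t ∈ Iic (0 : ℝ), ‖φ t‖ ≤ C) (hφ0 : φ 0 ≠ 0)
    (hψ : ∀ t ∈ Iic (0 : ℝ),
      HasDerivWithinAt ψ (-(ContinuousLinearMap.adjoint (A t) (ψ t))) (Iic 0) t)
    (horth : inner ℝ (φ 0) (ψ 0) = 0) :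
    ∃ α > 0, ∃ B > 0, ∀ t ∈ Iic (0 : ℝ), ‖ψ t‖ ≤ B * Real.exp (α * t) := by
  obtain ⟨M, -, hM⟩ := exists_bound_Iic hAc hA
  have hne := ne_zero_of_linear hM hφ hφ0
  obtain ⟨α, hα, T, hT, hrates⟩ := exists_rates hA hdet hφ hφC hne
  -- The pairing of a solution with an adjoint solution is constant, so `ψ` remains normal to `φ`
  -- and sees only the contracting normal rate of `A`.
  have hderiv : ∀ t ∈ Iic (0 : ℝ),
      HasDerivWithinAt (fun t => inner ℝ (φ t) (ψ t)) 0 (Iic 0) t := fun t ht =>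
    ((hφ t ht).inner ℝ (hψ t ht)).congr_deriv (by
      rw [inner_neg_right, ContinuousLinearMap.adjoint_inner_right]; ring)
  have horth' : ∀ t ∈ Iic (0 : ℝ), inner ℝ (φ t) (ψ t) = 0 := by
    intro t ht
    have h1 := monotoneOn_Iic_of_hasDerivWithinAt hderiv (fun _ _ => le_rfl) ht self_mem_Iic ht
    have h2 := antitoneOn_Iic_of_hasDerivWithinAt hderiv (fun _ _ => le_rfl) ht self_mem_Iic ht
    rw [← horth]
    exact le_antisymm h1 h2
  have hsub : Iic T ⊆ Iic (0 : ℝ) := Iic_subset_Iic.2 hT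
  have hψA : ∀ t ∈ Iic T, inner ℝ (ψ t) (A t (ψ t)) ≤ -α * ‖ψ t‖ ^ 2 := by
    intro t ht
    have he : ‖normalised (φ t)‖ = 1 := norm_normalised (hne t (hsub ht))
    have h1 := Plane.eq_frame he (ψ t)
    have h2 : inner ℝ (normalised (φ t)) (ψ t) = 0 := by
      rw [normalised, real_inner_smul_left, horth' t (hsub ht), mul_zero]
    rw [h2, zero_smul, zero_add] at h1
    rw [h1, map_smul, real_inner_smul_left, real_inner_smul_right, norm_smul, Plane.norm_rot, he,
      mul_one, Real.norm_eq_abs, sq_abs]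
    nlinarith [(hrates t ht).2, sq_nonneg (inner ℝ (Plane.rot (normalised (φ t))) (ψ t))]
  -- The minus sign in the adjoint equation gives `(‖ψ‖²)' ≥ 2α ‖ψ‖²`, that is, decay as `t → -∞`.
  have hmono := monotoneOn_Iic_of_hasDerivWithinAt (T := T)
    (fun t ht => ((hψ t (hsub ht)).mono hsub).norm_sq.mul
      ((((hasDerivAt_id t).const_mul (-(2 * α))).exp).hasDerivWithinAt)) (fun t ht => by
      have h1 := mul_nonneg (sub_nonneg.2 (hψA t ht)) (Real.exp_pos (-(2 * α) * t)).le
      rw [inner_neg_right, ContinuousLinearMap.adjoint_inner_right, real_inner_comm]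
      simp only [id]
      linarith)
  have hψc : ContinuousOn ψ (Iic 0) := fun t ht => (hψ t ht).continuousWithinAt
  obtain ⟨B, hB⟩ := (isCompact_Icc (a := T) (b := 0)).exists_bound_of_continuousOn
    (hψc.mono Icc_subset_Iic_self)
  have hB0 : 0 ≤ B := (norm_nonneg _).trans (hB T ⟨le_rfl, hT⟩)
  have hexp : ∀ t, (B + 1) * Real.exp (-α * T) * Real.exp (α * t) =
      (B + 1) * Real.exp (α * (t - T)) := fun t => by
    rw [mul_assoc, ← Real.exp_add]; congr 2; ring
  refine ⟨α, hα, (B + 1) * Real.exp (-α * T), by positivity, fun t ht => ?_⟩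
  rw [hexp]
  rcases le_total t T with h1 | h1
  · have h2 := hmono h1 self_mem_Iic h1
    simp only [id, Pi.mul_apply] at h2
    have h3 : ‖ψ t‖ ^ 2 ≤ (‖ψ T‖ * Real.exp (α * (t - T))) ^ 2 := by
      have h4 : Real.exp (α * (t - T)) ^ 2 = Real.exp (-(2 * α) * T) * Real.exp (2 * α * t) := by
        rw [← Real.exp_nat_mul, ← Real.exp_add]; congr 1; push_cast; ring
      have h5 : Real.exp (-(2 * α) * t) * Real.exp (2 * α * t) = 1 := by
        rw [← Real.exp_add]; simp
      calc ‖ψ t‖ ^ 2 = ‖ψ t‖ ^ 2 * Real.exp (-(2 * α) * t) * Real.exp (2 * α * t) := by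
            rw [mul_assoc, h5, mul_one]
        _ ≤ ‖ψ T‖ ^ 2 * Real.exp (-(2 * α) * T) * Real.exp (2 * α * t) := by gcongr
        _ = _ := by rw [mul_pow, h4]; ring
    refine (pow_le_pow_iff_left₀ (norm_nonneg _) (by positivity) two_ne_zero).1 h3 |>.trans ?_
    gcongr
    linarith [hB T ⟨le_rfl, hT⟩]
  · refine (hB t ⟨h1, ht⟩).trans ?_
    have h2 : 1 ≤ Real.exp (α * (t - T)) :=
      Real.one_le_exp (mul_nonneg hα.le (sub_nonneg.2 h1))
    nlinarith

theorem integrableOn_of_exp_bound {E : Type*} [NormedAddCommGroup E] {f : ℝ → E} {α B : ℝ}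
    (hα : 0 < α) (hf : ContinuousOn f (Iic 0))
    (hb : ∀ t ∈ Iic (0 : ℝ), ‖f t‖ ≤ B * Real.exp (α * t)) : IntegrableOn f (Iic 0) :=
  ((integrableOn_exp_mul_Iic hα 0).const_mul B).mono' (hf.aestronglyMeasurable measurableSet_Iic)
    ((ae_restrict_mem measurableSet_Iic).mono hb)

theorem norm_integral_le_of_exp_bound {E : Type*} [NormedAddCommGroup E] [NormedSpace ℝ E]
    {f : ℝ → E} {α B : ℝ} (hα : 0 < α)
    (hb : ∀ t ∈ Iic (0 : ℝ), ‖f t‖ ≤ B * Real.exp (α * t)) :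
    ‖∫ t in Iic (0 : ℝ), f t‖ ≤ B / α := by
  refine (norm_integral_le_of_norm_le ((integrableOn_exp_mul_Iic hα 0).const_mul B)
    ((ae_restrict_mem measurableSet_Iic).mono hb)).trans_eq ?_
  rw [integral_const_mul, integral_exp_mul_Iic hα]
  simp [div_eq_mul_inv]

namespace IsTransversalOrbit

variable {m : ℕ} {h : Plane → Param m → Plane} {μ₀ : Param m} {K : Set Plane} {p : Plane}
  {γ : ℝ → Plane} {c σ : ℝ}

theorem adjoint_equation (H : IsTransversalOrbit h μ₀ K p γ c σ) {ψ : ℝ → Plane}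
    (hψ : IsAdjointSolutionOn (fun x => h x μ₀) γ ψ (Iic 0)) :
    ∀ t ∈ Iic (0 : ℝ), HasDerivWithinAt ψ
      (-(ContinuousLinearMap.adjoint (stateDeriv h μ₀ (γ t)) (ψ t))) (Iic 0) t := fun t ht => by
  rw [← (H.hasFDerivAt_state (H.orbit_mem t ht)).fderiv]
  exact hψ t ht

/-- The functional whose integral along the orbit is the Melnikov integral. -/
noncomputable def _root_.melnikovFunctional {m : ℕ} (h : Plane → Param m → Plane) (μ₀ : Param m)
    (γ ψ : ℝ → Plane) (t : ℝ) : Param m →L[ℝ] ℝ :=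
  innerSL ℝ (ψ t) ∘L paramDeriv h μ₀ (γ t)

theorem melnikovFunctional_apply (H : IsTransversalOrbit h μ₀ K p γ c σ) (ψ : ℝ → Plane)
    (i : Fin m) {t : ℝ} (ht : t ∈ Iic (0 : ℝ)) :
    melnikovFunctional h μ₀ γ ψ t (EuclideanSpace.single i 1) =
      melnikovIntegrand h μ₀ γ ψ i t := by
  rw [melnikovIntegrand, (H.hasFDerivAt_param (H.orbit_mem t ht)).fderiv]
  rfl

theorem exists_decay (H : IsTransversalOrbit h μ₀ K p γ c σ) {ψ : ℝ → Plane}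
    (hψ : IsAdjointSolutionOn (fun x => h x μ₀) γ ψ (Iic 0))
    (horth : inner ℝ (h (γ 0) μ₀) (ψ 0) = 0) :
    ∃ α > 0, ∃ B > 0, ∀ t ∈ Iic (0 : ℝ), ‖ψ t‖ ≤ B * Real.exp (α * t) := by
  obtain ⟨C, -, hC⟩ := H.exists_bound_velocity
  refine exists_adjoint_decay H.continuousOn_stateDeriv_orbit H.tendsto_stateDeriv_orbit
    H.determinant_neg H.hasDerivWithinAt_velocity hC ?_ (H.adjoint_equation hψ) horth
  intro h0
  exact H.velocity_zero_ne (by rw [h0]; rfl)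

theorem integrableOn_melnikovFunctional (H : IsTransversalOrbit h μ₀ K p γ c σ) {ψ : ℝ → Plane}
    (hψ : IsAdjointSolutionOn (fun x => h x μ₀) γ ψ (Iic 0))
    (horth : inner ℝ (h (γ 0) μ₀) (ψ 0) = 0) :
    IntegrableOn (melnikovFunctional h μ₀ γ ψ) (Iic 0) := by
  obtain ⟨α, hα, B, hB, hdecay⟩ := H.exists_decay hψ horth
  obtain ⟨M, hM0, hM⟩ := exists_bound_Iic H.continuousOn_paramDeriv_orbit
    (((by fun_prop : Continuous fun L : Plane × Param m →L[ℝ] Plane =>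
      L ∘L ContinuousLinearMap.inr ℝ Plane (Param m)).tendsto _).comp H.tendsto_jointDeriv_orbit)
  have hψc : ContinuousOn ψ (Iic 0) := fun t ht => (hψ t ht).continuousWithinAt
  refine integrableOn_of_exp_bound (B := B * M) hα
    (((innerSL ℝ).continuous.comp_continuousOn hψc).clm_comp H.continuousOn_paramDeriv_orbit)
    fun t ht => ?_
  calc ‖melnikovFunctional h μ₀ γ ψ t‖ ≤ ‖innerSL ℝ (ψ t)‖ * ‖paramDeriv h μ₀ (γ t)‖ :=
        ContinuousLinearMap.opNorm_comp_le _ _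
    _ ≤ (B * Real.exp (α * t)) * M := by
        rw [innerSL_apply_norm]
        exact mul_le_mul (hdecay t ht) (hM t ht) (norm_nonneg _) (by positivity)
    _ = _ := by ring

theorem integrableOn_melnikovIntegrand (H : IsTransversalOrbit h μ₀ K p γ c σ) {ψ : ℝ → Plane}
    (hψ : IsAdjointSolutionOn (fun x => h x μ₀) γ ψ (Iic 0))
    (horth : inner ℝ (h (γ 0) μ₀) (ψ 0) = 0) (i : Fin m) :
    IntegrableOn (melnikovIntegrand h μ₀ γ ψ i) (Iic 0) :=
  IntegrableOn.congr_fun ((H.integrableOn_melnikovFunctional hψ horth).apply_continuousLinearMap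
    (EuclideanSpace.single i 1)) (fun _ ht => H.melnikovFunctional_apply ψ i ht) measurableSet_Iic

theorem integral_melnikovFunctional_apply (H : IsTransversalOrbit h μ₀ K p γ c σ) {ψ : ℝ → Plane}
    (hψ : IsAdjointSolutionOn (fun x => h x μ₀) γ ψ (Iic 0))
    (horth : inner ℝ (h (γ 0) μ₀) (ψ 0) = 0) (i : Fin m) :
    (∫ t in Iic (0 : ℝ), melnikovFunctional h μ₀ γ ψ t) (EuclideanSpace.single i 1) =
      ∫ t in Iic (0 : ℝ), melnikovIntegrand h μ₀ γ ψ i t := by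
  rw [ContinuousLinearMap.integral_apply (H.integrableOn_melnikovFunctional hψ horth)]
  exact setIntegral_congr_fun measurableSet_Iic fun _ ht => H.melnikovFunctional_apply ψ i ht

/-- The derivative, with respect to the parameter, of the point at which the perturbed trajectory
meets the section. -/
theorem hasFDerivAt_endpoint (H : IsTransversalOrbit h μ₀ K p γ c σ) {ψ : ℝ → Plane}
    (hψ : IsAdjointSolutionOn (fun x => h x μ₀) γ ψ (Iic 0))
    (horth : inner ℝ (h (γ 0) μ₀) (ψ 0) = 0) (hψ1 : ψ 0 1 ≠ 0) {X : Param m → ℝ → Plane} {C : ℝ}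
    (hC : 0 ≤ C)
    (hX : ∀ᶠ μ in 𝓝 μ₀, IsIntegralCurveOn (X μ) (fun _ y => h y μ) (Iic 0) ∧
      (∀ t ≤ 0, ‖X μ t - γ t‖ ≤ C * ‖μ - μ₀‖) ∧ X μ 0 0 = c) :
    HasFDerivAt (fun μ => X μ 0 1)
      ((ψ 0 1)⁻¹ • ∫ t in Iic (0 : ℝ), melnikovFunctional h μ₀ γ ψ t) μ₀ := by
  obtain ⟨α, hα, B, hB, hdecay⟩ := H.exists_decay hψ horth
  have hint := H.integrableOn_melnikovFunctional hψ horth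
  have hψd := H.adjoint_equation hψ
  have hψc : ContinuousOn ψ (Iic 0) := fun t ht => (hψ t ht).continuousWithinAt
  set W := ∫ t in Iic (0 : ℝ), melnikovFunctional h μ₀ γ ψ t with hW
  have hX0 : X μ₀ 0 = γ 0 := by
    have := hX.self_of_nhds.2.1 0 le_rfl
    rw [sub_self, norm_zero, mul_zero] at this
    exact sub_eq_zero.1 (norm_le_zero_iff.1 this)
  rw [hasFDerivAt_iff_isLittleO]
  refine Asymptotics.IsLittleO.of_bound fun ε hε => ?_
  -- Chosen so that `|ψ 0 1|⁻¹ · B η (C + 1) / α = ε` in the final estimate of the remainder.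
  set η := ε * |ψ 0 1| * α / (B * (C + 1)) with hη
  have hη0 : 0 < η := by have := abs_pos.2 hψ1; positivity
  obtain ⟨r, hr, hU⟩ := H.exists_uniform hη0
  filter_upwards [hX, eventually_norm_sub_lt μ₀ hr,
    eventually_norm_sub_lt μ₀ (show 0 < r / (C + 1) by positivity)] with μ ⟨hx, hxγ, hx0⟩ hμ hμ'
  set x := X μ
  set y : ℝ → Plane := fun t => x t - γ t with hy
  have hyr : ∀ t ∈ Iic (0 : ℝ), ‖y t‖ < r := fun t ht => by
    rw [lt_div_iff₀ (by positivity)] at hμ'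
    refine (hxγ t ht).trans_lt ?_
    nlinarith [norm_nonneg (μ - μ₀)]
  have hyd := H.hasDerivWithinAt_deviation hx
  set N := deviationForcing h μ₀ γ μ y
  set R : ℝ → Plane := fun t => h (x t) μ - h (γ t) μ₀ -
    jointDeriv h μ₀ (γ t) ((x t, μ) - (γ t, μ₀)) with hR
  have hRN : ∀ t, N t = paramDeriv h μ₀ (γ t) (μ - μ₀) + R t := by
    intro t
    have h1 : ((x t, μ) - (γ t, μ₀) : Plane × Param m) = (y t, 0) + (0, μ - μ₀) := by
      ext <;> simp [hy]
    have h2 : jointDeriv h μ₀ (γ t) (y t, 0) = stateDeriv h μ₀ (γ t) (y t) := rfl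
    have h3 : jointDeriv h μ₀ (γ t) (0, μ - μ₀) = paramDeriv h μ₀ (γ t) (μ - μ₀) := rfl
    simp only [hR]
    rw [h1, map_add, h2, h3]
    simp only [N, deviationForcing, hy, add_sub_cancel]
    abel
  have hRb : ∀ t ∈ Iic (0 : ℝ), ‖R t‖ ≤ η * ((C + 1) * ‖μ - μ₀‖) := by
    intro t ht
    refine (hU _ (H.orbit_mem t ht) (x t, μ) (mem_ball_prod (hyr t ht) hμ) _
      (Metric.mem_ball_self hr)).trans ?_
    gcongr
    rw [Prod.mk_sub_mk, Prod.norm_mk]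
    have := norm_nonneg (μ - μ₀)
    exact max_le ((hxγ t ht).trans (by linarith)) (by nlinarith)
  have hxc : ContinuousOn x (Iic 0) := fun t ht => (hx t ht).continuousWithinAt
  have hRc : ContinuousOn R (Iic 0) := by
    intro t ht
    have h1 : ContinuousWithinAt (fun t => h (x t) μ) (Iic 0) t :=
      ContinuousAt.comp_continuousWithinAt (g := fun q : Plane × Param m => h q.1 q.2)
        (f := fun t => (x t, μ))
        (continuousAt_of_strict_bound (H := fun q : Plane × Param m => h q.1 q.2)
          (hU _ (H.orbit_mem t ht)) (mem_ball_prod (hyr t ht) hμ))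
        ((hxc t ht).prodMk continuousWithinAt_const)
    exact (h1.sub (H.hasDerivWithinAt_velocity t ht).continuousWithinAt).sub
      ((H.continuousOn_jointDeriv_orbit t ht).clm_apply
        (((hxc t ht).prodMk continuousWithinAt_const).sub
          ((H.continuousOn_orbit t ht).prodMk continuousWithinAt_const)))
  have hψR : ∀ t ∈ Iic (0 : ℝ), ‖(inner ℝ (ψ t) (R t) : ℝ)‖ ≤
      B * (η * ((C + 1) * ‖μ - μ₀‖)) * Real.exp (α * t) := by
    intro t ht
    calc ‖(inner ℝ (ψ t) (R t) : ℝ)‖ ≤ ‖ψ t‖ * ‖R t‖ := norm_inner_le_norm _ _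
      _ ≤ (B * Real.exp (α * t)) * (η * ((C + 1) * ‖μ - μ₀‖)) :=
        mul_le_mul (hdecay t ht) (hRb t ht) (norm_nonneg _) (by positivity)
      _ = _ := by ring
  have hRint : IntegrableOn (fun t => (inner ℝ (ψ t) (R t) : ℝ)) (Iic 0) :=
    integrableOn_of_exp_bound hα (hψc.inner hRc) hψR
  have hMint : IntegrableOn (fun t => melnikovFunctional h μ₀ γ ψ t (μ - μ₀)) (Iic 0) :=
    hint.apply_continuousLinearMap _
  -- The terms with `A` and its adjoint cancel. What is left is the Melnikov functional applied to
  -- `μ - μ₀`, plus the pairing with the remainder `R`.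
  have hβd : ∀ t ∈ Iic (0 : ℝ), HasDerivWithinAt (fun t => (inner ℝ (ψ t) (y t) : ℝ))
      (melnikovFunctional h μ₀ γ ψ t (μ - μ₀) + inner ℝ (ψ t) (R t)) (Iic 0) t := by
    intro t ht
    refine ((hψd t ht).inner ℝ (hyd t ht)).congr_deriv ?_
    have h1 : melnikovFunctional h μ₀ γ ψ t (μ - μ₀) =
      inner ℝ (ψ t) (paramDeriv h μ₀ (γ t) (μ - μ₀)) := rfl
    rw [h1, ← inner_add_right, ← hRN, inner_neg_left, ContinuousLinearMap.adjoint_inner_left,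
      inner_add_right]
    ring
  have hβlim : Tendsto (fun t => (inner ℝ (ψ t) (y t) : ℝ)) atBot (𝓝 0) := by
    have h1 : Tendsto (fun s : ℝ => B * r * Real.exp (α * s)) atBot (𝓝 0) := by
      simpa using (Real.tendsto_exp_atBot.comp
        (tendsto_id.const_mul_atBot hα)).const_mul (B * r)
    refine squeeze_zero_norm' ?_ h1
    filter_upwards [eventually_le_atBot (0 : ℝ)] with t ht
    calc ‖(inner ℝ (ψ t) (y t) : ℝ)‖ ≤ ‖ψ t‖ * ‖y t‖ := norm_inner_le_norm _ _
      _ ≤ (B * Real.exp (α * t)) * r :=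
        mul_le_mul (hdecay t ht) (hyr t ht).le (norm_nonneg _) (by positivity)
      _ = _ := by ring
  have hkey := integral_Iic_of_hasDerivAt_of_tendsto
    (hβd 0 self_mem_Iic).continuousWithinAt
    (fun t ht => (hβd t (mem_Iic.2 (le_of_lt ht))).Iic_hasDerivAt ht) (hMint.add hRint) hβlim
  rw [integral_add hMint hRint, sub_zero, Plane.inner_eq] at hkey
  have hWapp : W (μ - μ₀) = ∫ t in Iic (0 : ℝ), melnikovFunctional h μ₀ γ ψ t (μ - μ₀) :=
    ContinuousLinearMap.integral_apply hint _
  -- Both endpoints lie on the vertical line, so the boundary term `⟨ψ 0, y 0⟩` reduces to `ψ 0 1`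
  -- times the vertical displacement.
  have hy00 : y 0 0 = 0 := by simp [hy, hx0, H.orbit_zero]
  have hy01 : y 0 1 = x 0 1 - γ 0 1 := rfl
  rw [hy00, mul_zero, zero_add, ← hWapp, hy01] at hkey
  have hrem := norm_integral_le_of_exp_bound hα hψR
  have hfin : x 0 1 - γ 0 1 - ((ψ 0 1)⁻¹ • W) (μ - μ₀) =
      (ψ 0 1)⁻¹ * ∫ t in Iic (0 : ℝ), (inner ℝ (ψ t) (R t) : ℝ) := by
    rw [smul_apply, smul_eq_mul]
    field_simp
    linarith
  rw [hX0, hfin, norm_mul, norm_inv, Real.norm_eq_abs (ψ 0 1)]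
  have hψpos := abs_pos.2 hψ1
  calc |ψ 0 1|⁻¹ * ‖∫ t in Iic (0 : ℝ), (inner ℝ (ψ t) (R t) : ℝ)‖
      ≤ |ψ 0 1|⁻¹ * (B * (η * ((C + 1) * ‖μ - μ₀‖)) / α) := by gcongr
    _ = ε * ‖μ - μ₀‖ := by rw [hη]; field_simp

end IsTransversalOrbit

/-- For parameters near `μ₀` the invariant manifold of the continued saddle meets the section, near
the reference orbit, in exactly one point, which depends differentiably on the parameter. -/
theorem IsTransversalOrbit.exists_intersection {m : ℕ} {h : Plane → Param m → Plane} {μ₀ : Param m}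
    {K : Set Plane} {p : Plane} {γ ψ : ℝ → Plane} {a b c σ : ℝ}
    (H : IsTransversalOrbit h μ₀ K p γ c σ)
    (hψ : IsAdjointSolutionOn (fun x => h x μ₀) γ ψ (Iic 0))
    (horth : inner ℝ (h (γ 0) μ₀) (ψ 0) = 0) (hψ1 : ψ 0 1 ≠ 0) (hab : γ 0 1 ∈ Ioo a b) :
    ∃ (P z : Param m → Plane) (ε₀ : ℝ), IsSaddleContinuation h μ₀ p P ∧ 0 < ε₀ ∧
      (∀ ε : ℝ, 0 < ε → ε ≤ ε₀ → ∀ᶠ μ in 𝓝 μ₀,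
        {w | ∃ x : ℝ → Plane, IsIntegralCurveOn x (fun _ y => h y μ) (Iic 0) ∧
          Tendsto x atBot (𝓝 (P μ)) ∧ (∀ t < 0, σ * x t 0 < σ * c) ∧
          (∀ t ≤ 0, dist (x t) (γ t) < ε) ∧ x 0 = w} ∩ verticalSection c a b = {z μ}) ∧
      HasFDerivAt (fun μ => z μ 1)
        ((ψ 0 1)⁻¹ • ∫ t in Iic (0 : ℝ), melnikovFunctional h μ₀ γ ψ t) μ₀ := by
  obtain ⟨P, hP⟩ := exists_saddleContinuation (H.contDiffAt p H.saddle_mem) H.isSaddle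
  obtain ⟨r₁, hr₁, h₁⟩ := H.exists_tendsto hP
  obtain ⟨r₂, hr₂, h₂⟩ := H.exists_side
  obtain ⟨r₃, hr₃, C, hC, h₃⟩ := H.exists_unique_nearby
  -- This radius keeps endpoints of nearby trajectories inside the segment, not merely on its line.
  obtain ⟨r₄, hr₄, h₄⟩ := Metric.isOpen_iff.1 isOpen_Ioo _ hab
  obtain ⟨X, hX⟩ := h₃.choice
  set ε₀ := min (min r₁ r₂) (min r₃ r₄)
  refine ⟨P, fun μ => X μ 0, ε₀, hP, lt_min (lt_min hr₁ hr₂) (lt_min hr₃ hr₄),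
    fun ε hε hεε => ?_, H.hasFDerivAt_endpoint hψ horth hψ1 hC.le
      (hX.mono fun μ hμ => ⟨hμ.1, hμ.2.1, hμ.2.2.1⟩)⟩
  have hε₁ : ε ≤ r₁ := hεε.trans ((min_le_left _ _).trans (min_le_left _ _))
  have hε₂ : ε ≤ r₂ := hεε.trans ((min_le_left _ _).trans (min_le_right _ _))
  have hε₃ : ε ≤ r₃ := hεε.trans ((min_le_right _ _).trans (min_le_left _ _))
  have hε₄ : ε ≤ r₄ := hεε.trans ((min_le_right _ _).trans (min_le_right _ _))
  filter_upwards [h₁, h₂, hX, eventually_norm_sub_lt μ₀ (show 0 < ε / C by positivity)]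
    with μ k₁ k₂ ⟨hx, hxγ, hx0, huniq⟩ hμ
  have hclose : ∀ t ≤ 0, dist (X μ t) (γ t) < ε := fun t ht => by
    rw [dist_eq_norm]
    refine (hxγ t ht).trans_lt ?_
    rw [lt_div_iff₀ hC] at hμ
    linarith
  refine Subset.antisymm ?_ (singleton_subset_iff.2 ⟨⟨X μ, hx,
    k₁ _ hx fun t ht => (hclose t ht).trans_le hε₁,
    k₂ _ hx (fun t ht => (hclose t ht).trans_le hε₂) hx0, hclose, rfl⟩, hx0, ?_⟩)
  · rintro w ⟨⟨x, hxc, -, -, hxε, rfl⟩, hw0, -⟩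
    exact huniq x hxc (fun t ht => (hxε t ht).trans_le hε₃) hw0
  · refine Ioo_subset_Icc_self (h₄ ?_)
    rw [Metric.mem_ball, dist_eq_norm]
    have h5 : ‖(X μ 0 - γ 0) 1‖ ≤ ‖X μ 0 - γ 0‖ := PiLp.norm_apply_le _ _
    rw [← dist_eq_norm (X μ 0)] at h5
    exact (h5.trans_lt (hclose 0 le_rfl)).trans_le hε₄

/-! ### Time reversal, from stable to unstable half-orbits. -/

section TimeReversal

theorem IsIntegralCurveOn.reverse_Ici {E : Type*} [NormedAddCommGroup E] [NormedSpace ℝ E]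
    {x : ℝ → E} {v : ℝ → E → E} (hx : IsIntegralCurveOn x v (Ici 0)) :
    IsIntegralCurveOn (fun t => x (-t)) (fun t y => -v (-t) y) (Iic 0) := fun t ht =>
  (HasDerivWithinAt.scomp t (hx (-t) (by simpa using ht)) (hasDerivAt_neg t).hasDerivWithinAt
    (fun s hs => by simpa using hs)).congr_deriv (by simp)

theorem IsIntegralCurveOn.reverse_Iic {E : Type*} [NormedAddCommGroup E] [NormedSpace ℝ E]
    {x : ℝ → E} {v : ℝ → E → E} (hx : IsIntegralCurveOn x v (Iic 0)) :
    IsIntegralCurveOn (fun t => x (-t)) (fun t y => -v (-t) y) (Ici 0) := fun t ht =>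
  (HasDerivWithinAt.scomp t (hx (-t) (by simpa using ht)) (hasDerivAt_neg t).hasDerivWithinAt
    (fun s hs => by simpa using hs)).congr_deriv (by simp)

theorem IsSaddle.neg {f : Plane → Plane} {p : Plane} (hf : IsSaddle f p) :
    IsSaddle (fun x => -f x) p := by
  rw [isSaddle_iff] at hf ⊢
  refine ⟨by rw [hf.1, neg_zero], ?_⟩
  rw [fderiv_fun_neg]
  simpa [Plane.determinant, Plane.entry] using hf.2

theorem IsAdjointSolutionOn.reverse_Ici {f : Plane → Plane} {γ ψ : ℝ → Plane}
    (hψ : IsAdjointSolutionOn f γ ψ (Ici 0)) :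
    IsAdjointSolutionOn (fun x => -f x) (fun t => γ (-t)) (fun t => ψ (-t)) (Iic 0) := by
  have := IsIntegralCurveOn.reverse_Ici hψ
  intro t ht
  refine (this t ht).congr_deriv ?_
  simp only [fderiv_fun_neg, map_neg, neg_apply]

theorem melnikovIntegrand_reverse {m : ℕ} (h : Plane → Param m → Plane) (μ₀ : Param m)
    (γ ψ : ℝ → Plane) (i : Fin m) (s : ℝ) :
    melnikovIntegrand (fun x μ => -h x μ) μ₀ (fun t => γ (-t)) (fun t => ψ (-t)) i s =
      -melnikovIntegrand h μ₀ γ ψ i (-s) := by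
  simp only [melnikovIntegrand]
  rw [fderiv_fun_neg, neg_apply, inner_neg_right]

theorem integrableOn_melnikovIntegrand_of_reverse {m : ℕ} {h : Plane → Param m → Plane}
    {μ₀ : Param m} {γ ψ : ℝ → Plane} {i : Fin m}
    (hi : IntegrableOn (melnikovIntegrand (fun x μ => -h x μ) μ₀ (fun t => γ (-t))
      (fun t => ψ (-t)) i) (Iic 0)) :
    IntegrableOn (melnikovIntegrand h μ₀ γ ψ i) (Ici 0) := by
  have h1 : IntegrableOn (fun t => melnikovIntegrand h μ₀ γ ψ i (-t)) (Iic 0) := by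
    refine IntegrableOn.congr_fun hi.neg (fun t _ => ?_) measurableSet_Iic
    rw [Pi.neg_apply, melnikovIntegrand_reverse, neg_neg]
  rw [← neg_zero] at h1
  simpa only [neg_neg] using h1.comp_neg_Ici

/-- The minus sign comes from negating the field. It cancels the minus sign of `z^u - z^s`, which is
why both integrals enter the final formula with a plus. -/
theorem integral_melnikovIntegrand_reverse {m : ℕ} (h : Plane → Param m → Plane) (μ₀ : Param m)
    (γ ψ : ℝ → Plane) (i : Fin m) :
    ∫ t in Iic (0 : ℝ), melnikovIntegrand (fun x μ => -h x μ) μ₀ (fun t => γ (-t))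
      (fun t => ψ (-t)) i t = -∫ t in Ici (0 : ℝ), melnikovIntegrand h μ₀ γ ψ i t := by
  simp only [melnikovIntegrand_reverse]
  rw [integral_neg, integral_comp_neg_Iic, neg_zero, integral_Ici_eq_integral_Ioi]

theorem stableSegment_eq_reverse (f : Plane → Plane) (q : Plane) (c : ℝ) (γ : ℝ → Plane) (ε : ℝ) :
    stableSegment f q c γ ε =
      {w | ∃ x : ℝ → Plane, IsIntegralCurveOn x (fun _ y => -f y) (Iic 0) ∧
          Tendsto x atBot (𝓝 q) ∧ (∀ t < 0, -1 * x t 0 < -1 * c) ∧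
          (∀ t ≤ 0, dist (x t) (γ (-t)) < ε) ∧ x 0 = w} := by
  ext w
  constructor
  · rintro ⟨x, h1, h2, h3, h4, h5⟩
    refine ⟨fun t => x (-t), h1.reverse_Ici, h2.comp tendsto_neg_atBot_atTop, fun t ht => ?_,
      fun t ht => h4 (-t) (by linarith), by simpa using h5⟩
    linarith [h3 (-t) (by linarith)]
  · rintro ⟨x, h1, h2, h3, h4, h5⟩
    refine ⟨fun t => x (-t), ?_, h2.comp tendsto_neg_atTop_atBot, fun t ht => ?_,
      fun t ht => by simpa using h4 (-t) (by linarith), by simpa using h5⟩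
    · simpa using h1.reverse_Iic
    · linarith [h3 (-t) (by linarith)]

end TimeReversal

/-! ### Assembly of the two half-orbits. -/

theorem inner_normalised_normal (w : Plane) :
    inner ℝ w (!₂[-(normalised w 1), normalised w 0] : Plane) = 0 := by
  rw [Plane.inner_eq]
  simp [normalised]
  ring

theorem normalised_zero_ne {w : Plane} (hw : 0 < w 0) : normalised w 0 ≠ 0 := by
  have h0 : w ≠ 0 := by rintro rfl; simp at hw
  simp only [normalised, PiLp.smul_apply, smul_eq_mul]
  exact mul_ne_zero (inv_ne_zero (norm_ne_zero_iff.2 h0)) hw.ne'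

theorem mainTheorem3 {m : ℕ} (c a b δ : ℝ) (hδ : 0 < δ)
    -- the vector fields, smooth near the compact sets `Vm`, `Vp` for parameters in `P`
    (hm hp : Plane → Param m → Plane) (Vm Vp : Set Plane) (P : Set (Param m))
    (hVm : IsCompact Vm) (hVp : IsCompact Vp)
    (hVm_strip : ∀ x ∈ Vm, x 0 < c + δ) (hVp_strip : ∀ x ∈ Vp, c - δ < x 0)
    (hm_smooth : ∀ x ∈ Vm, ∀ μ ∈ P,
      ContDiffAt ℝ ∞ (fun q : Plane × Param m => hm q.1 q.2) (x, μ))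
    (hp_smooth : ∀ x ∈ Vp, ∀ μ ∈ P,
      ContDiffAt ℝ ∞ (fun q : Plane × Param m => hp q.1 q.2) (x, μ))
    -- the vertical section, crossed from left to right
    (hsec : verticalSection c a b ⊆ Vm ∩ Vp)
    (hcross : ∀ μ ∈ P, ∀ z ∈ verticalSection c a b, z 1 ∈ Ioo a b → 0 < hm z μ 0 ∧ 0 < hp z μ 0)
    (μ₀ : Param m) (hμ₀ : μ₀ ∈ interior P)
    -- the saddles
    (pm pp : Plane) (hpm_mem : pm ∈ Vm) (hpm_lt : pm 0 < c) (hpp_mem : pp ∈ Vp) (hpp_gt : c < pp 0)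
    (hpm : IsSaddle (fun x => hm x μ₀) pm) (hpp : IsSaddle (fun x => hp x μ₀) pp)
    -- the piecewise-smooth heteroclinic orbit, meeting the section at `xs` at time `0`
    (γm γp : ℝ → Plane) (xs : Plane)
    (hγm : IsIntegralCurveOn γm (fun _ x => hm x μ₀) (Iic 0))
    (hγp : IsIntegralCurveOn γp (fun _ x => hp x μ₀) (Ici 0))
    (hγm_lim : Tendsto γm atBot (𝓝 pm)) (hγp_lim : Tendsto γp atTop (𝓝 pp))
    (hγm_mem : ∀ t < 0, γm t ∈ Vm ∧ γm t 0 < c) (hγp_mem : ∀ t > 0, γp t ∈ Vp ∧ c < γp t 0)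
    (hγm_zero : γm 0 = xs) (hγp_zero : γp 0 = xs)
    (hxs : xs ∈ verticalSection c a b) (hxs_int : xs 1 ∈ Ioo a b)
    -- the normalised vector fields at the crossing point and the adjoint solutions
    (vm vp : Plane) (hvm : vm = normalised (hm xs μ₀)) (hvp : vp = normalised (hp xs μ₀))
    (ψm ψp : ℝ → Plane)
    (hψm : IsAdjointSolutionOn (fun x => hm x μ₀) γm ψm (Iic 0))
    (hψp : IsAdjointSolutionOn (fun x => hp x μ₀) γp ψp (Ici 0))
    (hψm_zero : ψm 0 = !₂[-(vm 1), vm 0]) (hψp_zero : ψp 0 = !₂[-(vp 1), vp 0]) :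
    -- the saddles persist, and near the orbit each of `W^u(p₋)`, `W^s(p₊)` meets the section in
    -- exactly one point `zu μ`, `zs μ`
    ∃ (Pm Pp zu zs : Param m → Plane) (ε₀ : ℝ),
      IsSaddleContinuation hm μ₀ pm Pm ∧ IsSaddleContinuation hp μ₀ pp Pp ∧ 0 < ε₀ ∧
      (∀ ε : ℝ, 0 < ε → ε ≤ ε₀ → ∀ᶠ μ in 𝓝 μ₀,
        unstableSegment (fun x => hm x μ) (Pm μ) c γm ε ∩ verticalSection c a b = {zu μ} ∧
        stableSegment (fun x => hp x μ) (Pp μ) c γp ε ∩ verticalSection c a b = {zs μ}) ∧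
      -- the derivatives of the vertical distance are the weighted one-sided Melnikov integrals
      DifferentiableAt ℝ (fun μ => zu μ 1 - zs μ 1) μ₀ ∧
      ∀ i : Fin m,
        IntegrableOn (melnikovIntegrand hm μ₀ γm ψm i) (Iic 0) ∧
        IntegrableOn (melnikovIntegrand hp μ₀ γp ψp i) (Ici 0) ∧
        fderiv ℝ (fun μ => zu μ 1 - zs μ 1) μ₀ (EuclideanSpace.single i 1) =
          1 / vm 0 * (∫ s in Iic (0 : ℝ), melnikovIntegrand hm μ₀ γm ψm i s) +
          1 / vp 0 * (∫ s in Ici (0 : ℝ), melnikovIntegrand hp μ₀ γp ψp i s) := by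
  have hμP : μ₀ ∈ P := interior_subset hμ₀
  obtain ⟨hcm, hcp⟩ := hcross μ₀ hμP xs hxs hxs_int
  have Hm : IsTransversalOrbit hm μ₀ Vm pm γm c 1 :=
    { isCompact := hVm
      contDiffAt := fun k hk => (hm_smooth k hk μ₀ hμP).of_le (by simp)
      saddle_mem := hpm_mem
      orbit_mem := fun t ht => by
        rcases (mem_Iic.1 ht).eq_or_lt with rfl | h
        · rw [hγm_zero]; exact (hsec hxs).1
        · exact (hγm_mem t h).1
      isSaddle := hpm
      isIntegralCurveOn := hγm
      tendsto := hγm_lim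
      saddle_side := by linarith
      orbit_side := fun t ht => by linarith [(hγm_mem t ht).2]
      orbit_zero := by rw [hγm_zero]; exact hxs.1
      transversal := by rw [hγm_zero]; linarith }
  -- The reversed orbit lies to the right of the section and moves left under `-hp`. With `σ = -1`
  -- both signs are absorbed and transversality again reads as positivity.
  have Hp : IsTransversalOrbit (fun x μ => -hp x μ) μ₀ Vp pp (fun t => γp (-t)) c (-1) :=
    { isCompact := hVp
      contDiffAt := fun k hk => ((hp_smooth k hk μ₀ hμP).of_le (by simp)).neg
      saddle_mem := hpp_mem
      orbit_mem := fun t ht => by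
        rcases (mem_Iic.1 ht).eq_or_lt with rfl | h
        · rw [neg_zero, hγp_zero]; exact (hsec hxs).2
        · exact (hγp_mem (-t) (by linarith)).1
      isSaddle := hpp.neg
      isIntegralCurveOn := hγp.reverse_Ici
      tendsto := hγp_lim.comp tendsto_neg_atBot_atTop
      saddle_side := by linarith
      orbit_side := fun t ht => by linarith [(hγp_mem (-t) (by linarith)).2]
      orbit_zero := by rw [neg_zero, hγp_zero]; exact hxs.1
      transversal := by
        rw [neg_zero, hγp_zero, PiLp.neg_apply]; linarith }
  have hm_orth : inner ℝ (hm (γm 0) μ₀) (ψm 0) = 0 := by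
    rw [hγm_zero, hψm_zero, hvm]; exact inner_normalised_normal _
  have hp_orth : inner ℝ (-hp (γp (-0)) μ₀) (ψp (-0)) = 0 := by
    rw [neg_zero, hγp_zero, hψp_zero, hvp, inner_neg_left, inner_normalised_normal, neg_zero]
  have hψm1 : ψm 0 1 = vm 0 := by rw [hψm_zero]; simp
  have hψp1 : ψp (-0) 1 = vp 0 := by rw [neg_zero, hψp_zero]; simp
  have hvm0 : vm 0 ≠ 0 := by rw [hvm]; exact normalised_zero_ne hcm
  have hvp0 : vp 0 ≠ 0 := by rw [hvp]; exact normalised_zero_ne hcp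
  have hψp' := hψp.reverse_Ici
  obtain ⟨Pm, zu, ε₁, hPm, hε₁, hsegm, hdm⟩ := Hm.exists_intersection (a := a) (b := b) hψm hm_orth
    (by rwa [hψm1]) (by rwa [hγm_zero])
  obtain ⟨Pp, zs, ε₂, hPp, hε₂, hsegp, hdp⟩ := Hp.exists_intersection (a := a) (b := b) hψp'
    hp_orth (by rwa [hψp1]) (by rwa [neg_zero, hγp_zero])
  have hd := hdm.fun_sub hdp
  refine ⟨Pm, Pp, zu, zs, min ε₁ ε₂, hPm, ⟨hPp.1, hPp.2.1, hPp.2.2.mono fun μ hμ => ?_⟩,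
    lt_min hε₁ hε₂, fun ε hε hεε => ?_, hd.differentiableAt, fun i => ?_⟩
  -- The continuation was found for `-hp`, and negating once more returns saddles of `hp`.
  · simpa using hμ.neg
  · filter_upwards [hsegm ε hε (hεε.trans (min_le_left _ _)),
      hsegp ε hε (hεε.trans (min_le_right _ _))] with μ h1 h2
    refine ⟨?_, ?_⟩
    · simpa only [one_mul, unstableSegment] using h1
    · rw [stableSegment_eq_reverse]; exact h2
  · refine ⟨Hm.integrableOn_melnikovIntegrand hψm hm_orth i,
      integrableOn_melnikovIntegrand_of_reverse (Hp.integrableOn_melnikovIntegrand hψp' hp_orth i),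
      ?_⟩
    rw [hd.fderiv, sub_apply, smul_apply, smul_apply,
      Hm.integral_melnikovFunctional_apply hψm hm_orth,
      Hp.integral_melnikovFunctional_apply hψp' hp_orth, integral_melnikovIntegrand_reverse, hψm1,
      hψp1]
    simp only [smul_eq_mul]
    ring
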